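/- Let $H$ be a separable infinite-dimensional complex Hilbert space, let $\Gamma=\{z\in\mathbb{C}:|z|=1\}$, and let $\Lambda\subset\Gamma$ be a countable set. Consider the set $M$ of all bounded linear operators $T$ on $H$ with the following two properties: (1) there exist $n_1<n_2<\cdots$ in $\mathbb{N}$ such that the set $\{n_j : j\ge 1\}$ has density $1$, i.e. $\lim_{n\to\infty}\frac{1}{n}\#\big(\{n_j : j\ge 1\}\cap\{1,\dots,n\}\big)=1$, and $\lim_{j\to\infty}T^{n_j}=0$ in the weak operator topology; (2) for every $\lambda\in\Lambda$ there is a sequence $(n_j^{(\lambda)})_{j\ge1}$ in $\mathbb{N}$ with $\lim_{j\to\infty} n_j^{(\lambda)}=\infty$ and $\lim_{j\to\infty}T^{n_j^{(\lambda)}}=\lambda I$ in the strong operator topology. Then $M\cap\mathcal{C}$ is residual in the set $\mathcal{C}$ of all contractions ($\|T\|\le 1$) on $H$ endowed with the weak operator topology; $M\cap\mathcal{I}$ is residual in the set $\mathcal{I}$ of all (not necessarily surjective) linear isometries of $H$ into itself endowed with the strong operator topology; and $M\cap\mathcal{U}$ is residual in the set $\mathcal{U}$ of all unitary operators on $H$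 endowed with the strong* operator topology, i.e. the topology defined by the seminorms $T\mapsto\sqrt{\|Tx\|^2+\|T^*x\|^2}$, $x\in H$. Here a subset of a topological space is called residual if it contains a countable intersection of dense open sets. -/

import Mathlib

open Filter Topology

noncomputable section

/-- The set `M ⊆ ℕ` has natural density `d`, i.e. the limit of `#(M ∩ {1, …, n}) / n` as
`n → ∞` exists and equals `d`. -/
def HasNatDensity (M : Set ℕ) (d : ℝ) : Prop :=
  Tendsto (fun n : ℕ => ((M ∩ Set.Icc 1 n).ncard : ℝ) / n) atTop (𝓝 d)

/-- `S ∩ A` is residual in the subspace `A` of the space `X` with topology `t`, i.e. it contains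
a countable intersection of relatively open dense subsets of `A`. -/
def IsResidualIn {X : Type*} (t : TopologicalSpace X) (A S : Set X) : Prop :=
  (Subtype.val ⁻¹' S : Set A) ∈ @residual A (t.induced Subtype.val)

section Operators

variable (H : Type*) [NormedAddCommGroup H] [InnerProductSpace ℂ H]

/-- The weak operator topology on the bounded operators on `H`
(transported from Mathlib's type synonym `H →WOT[ℂ] H`). -/
abbrev weakOperatorTopology : TopologicalSpace (H →L[ℂ] H) :=
  TopologicalSpace.induced
    (ContinuousLinearMapWOT.ofCLM : (H →L[ℂ] H) → (H →WOT[ℂ] H)) inferInstance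

/-- The strong operator topology on the bounded operators on `H`: the topology of pointwise
norm convergence `T x`, `x ∈ H`. -/
abbrev strongOperatorTopology : TopologicalSpace (H →L[ℂ] H) :=
  TopologicalSpace.induced (fun (T : H →L[ℂ] H) (x : H) => T x) Pi.topologicalSpace

/-- The strong* operator topology on the bounded operators on `H`: the coarsest topology for which
`T ↦ T x` and `T ↦ T* x` are continuous for every `x ∈ H`. -/
abbrev strongStarOperatorTopology [CompleteSpace H] : TopologicalSpace (H →L[ℂ] H) :=
  strongOperatorTopology H ⊓
    (strongOperatorTopology H).induced (fun T : H →L[ℂ] H => ContinuousLinearMap.adjoint T)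

/-- The contractions on `H`. -/
def contractionSet : Set (H →L[ℂ] H) := {T | ‖T‖ ≤ 1}

/-- The (not necessarily surjective) isometric operators on `H`. -/
def isometrySet : Set (H →L[ℂ] H) := {T | ∀ x : H, ‖T x‖ = ‖x‖}

/-- The unitary operators on `H`. -/
def unitarySet [CompleteSpace H] : Set (H →L[ℂ] H) := {T | T ∈ unitary (H →L[ℂ] H)}

variable {H}

/-- `T` is almost weakly stable: `T ^ n_j → 0` weakly along a strictly increasing sequence
`(n_j)` of density `1`. -/
def IsAlmostWeaklyStable (T : H →L[ℂ] H) : Prop :=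
  ∃ n : ℕ → ℕ, StrictMono n ∧ HasNatDensity (Set.range n) 1 ∧
    Tendsto (fun j => T ^ n j) atTop (@nhds _ (weakOperatorTopology H) 0)

/-- `T` is `μ`-rigid: `T ^ n_j → μ I` strongly for some sequence `n_j → ∞`. -/
def IsRigidAt (T : H →L[ℂ] H) (μ : ℂ) : Prop :=
  ∃ n : ℕ → ℕ, Tendsto n atTop atTop ∧
    Tendsto (fun j => T ^ n j) atTop
      (@nhds _ (strongOperatorTopology H) (μ • ContinuousLinearMap.id ℂ H))

end Operators

end

/-! ### Extending finite-dimensional isometries to unitaries -/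

section HilbertExtension

variable {H X : Type*} [NormedAddCommGroup H] [InnerProductSpace ℂ H] [CompleteSpace H]
  [TopologicalSpace.SeparableSpace H] [NormedAddCommGroup X] [InnerProductSpace ℂ X]
  [CompleteSpace X] [TopologicalSpace.SeparableSpace X]

/-! In each of the three spaces the unitaries form a dense relative Gδ, and on them evaluation at a
vector is continuous. It therefore suffices to find countably many relatively open conditions on
unitaries, each dense for the strong* topology (the finest of the three), that together force both
properties.

Rigidity at `μ` asks for late powers close to `μ` at finitely many vectors. Weak stability asks for
one `N` such that the Gram matrix of `x, Tx, …, T^(N-1)x` is small on average. As `T` is isometric,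
every block of `N` consecutive orbit points has that Gram matrix, so a Bessel-type inequality makes
the means of `|⟨T^n x, y⟩|²` tend to `0`. The Koopman–von Neumann argument then extracts a set of
density one, common to a dense sequence of pairs.

Both density claims rest on `LinearIsometryEquiv.exists_near_pow_eq_smul`. A long piece of `W`-orbit
is spread over the first `L` slots of `H^N`, where a cyclic shift nearly acts as `W`, has `N`-th
power `μ`, and moves the occupied slots off themselves at intermediate times. Only a
finite-dimensional subspace matters, so the model is carried back to `H` by a unitary. -/

theorem Orthonormal.countable_of_separable {H : Type*} [NormedAddCommGroup H]
    [InnerProductSpace ℂ H] [TopologicalSpace.SeparableSpace H] {ι : Type*} {v : ι → H}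
    (hv : Orthonormal ℂ v) :
    Countable ι := by
  have hd : Pairwise (Function.onFun Disjoint fun i => Metric.ball (v i) (1 / 2)) := by
    intro i j hij
    refine Metric.ball_disjoint_ball ?_
    have h1 := @norm_sub_sq ℂ H _ _ _ (v i) (v j)
    rw [hv.2 hij, hv.1 i, hv.1 j] at h1
    norm_num at h1
    rw [dist_eq_norm]
    nlinarith [norm_nonneg (v i - v j)]
  exact hd.countable_of_isOpen_disjoint (fun i => Metric.isOpen_ball)
    fun i => ⟨v i, Metric.mem_ball_self (by norm_num)⟩

/-- The index type depends only on `d`, so bases built in two different spaces can be matched term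
by term. -/
theorem Orthonormal.exists_hilbertBasis_sum_nat (hH : ¬ FiniteDimensional ℂ H) {d : ℕ}
    {v : Fin d → H} (hv : Orthonormal ℂ v) :
    ∃ b : HilbertBasis (Fin d ⊕ ℕ) ℂ H, ∀ i, b (Sum.inl i) = v i := by
  obtain ⟨w, b, hw, hb⟩ := hv.toSubtypeRange.exists_hilbertBasis_extension
  have hcount : Countable w := b.orthonormal.countable_of_separable
  have hinf : Infinite w := by
    by_contra h
    rw [not_infinite_iff_finite] at h
    have := Fintype.ofFinite w
    exact hH (b.toOrthonormalBasis.toBasis.finiteDimensional_of_finite)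
  have hdiff : (w \ Set.range v).Infinite :=
    Set.Infinite.sdiff (Set.infinite_coe_iff.1 hinf) (Set.finite_range v)
  have := hdiff.to_subtype
  have hc' : Countable ↥(w \ Set.range v) := (Set.countable_coe_iff.1 hcount).mono Set.sdiff_subset
  obtain ⟨e⟩ := nonempty_equiv_of_countable (α := ℕ) (β := ↥(w \ Set.range v))
  let f : Fin d ⊕ ℕ → w := Sum.elim (fun i => ⟨v i, hw ⟨i, rfl⟩⟩) (fun n => ⟨e n, (e n).2.1⟩)
  have hf : Function.Injective f := by
    refine Function.Injective.sumElim ?_ ?_ ?_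
    · intro i j h
      exact hv.linearIndependent.injective (Subtype.ext_iff.1 h)
    · intro i j h
      have h' := Subtype.ext_iff.1 h
      exact e.injective (Subtype.ext h')
    · intro i j h
      exact (e j).2.2 ⟨i, Subtype.ext_iff.1 h⟩
  have hfs : Function.Surjective f := by
    rintro ⟨x, hx⟩
    by_cases h : x ∈ Set.range v
    · obtain ⟨i, rfl⟩ := h
      exact ⟨Sum.inl i, rfl⟩
    · exact ⟨Sum.inr (e.symm ⟨x, hx, h⟩), by simp [f]⟩
  have hu : Orthonormal ℂ (b ∘ f) := b.orthonormal.comp f hf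
  refine ⟨HilbertBasis.mk hu ?_, fun i => ?_⟩
  · rw [hfs.range_comp, b.dense_span]
  · simp [hb, f]

/-- An isometry defined on a finite-dimensional subspace extends to a unitary equivalence of
separable infinite-dimensional Hilbert spaces. -/
theorem LinearIsometry.exists_linearIsometryEquiv_extension (hH : ¬ FiniteDimensional ℂ H)
    (hX : ¬ FiniteDimensional ℂ X) (E : Submodule ℂ H) [FiniteDimensional ℂ E] (φ : E →ₗᵢ[ℂ] X) :
    ∃ Q : H ≃ₗᵢ[ℂ] X, ∀ e : E, Q e = φ e := by
  let b := stdOrthonormalBasis ℂ E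
  obtain ⟨c, hc⟩ := (b.orthonormal.comp_linearIsometry E.subtypeₗᵢ).exists_hilbertBasis_sum_nat hH
  obtain ⟨c', hc'⟩ := (b.orthonormal.comp_linearIsometry φ).exists_hilbertBasis_sum_nat hX
  let Q := c.repr.trans c'.repr.symm
  have hQ : ∀ i, Q (c i) = c' i := by
    intro i
    classical
    simp [Q, c.repr_self]
  refine ⟨Q, fun e => ?_⟩
  have : (Q.toLinearEquiv.toLinearMap ∘ₗ E.subtype) = φ.toLinearMap := by
    refine b.toBasis.ext fun i => ?_
    have h := hQ (Sum.inl i)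
    rw [hc, hc'] at h
    simpa using h
  exact LinearMap.congr_fun this e

theorem Submodule.not_finiteDimensional_orthogonal {H : Type*} [NormedAddCommGroup H]
    [InnerProductSpace ℂ H] (hH : ¬ FiniteDimensional ℂ H)
    (E : Submodule ℂ H) [FiniteDimensional ℂ E] : ¬ FiniteDimensional ℂ Eᗮ := by
  intro h
  have := Submodule.finiteDimensional_sup E Eᗮ
  rw [Submodule.sup_orthogonal_of_hasOrthogonalProjection] at this
  exact hH (Submodule.topEquiv.finiteDimensional)

/-- A contraction has a defect operator. -/
theorem ContinuousLinearMap.exists_defect {H : Type*} [NormedAddCommGroup H]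
    [InnerProductSpace ℂ H] [CompleteSpace H] (T : H →L[ℂ] H) (hT : ‖T‖ ≤ 1) :
    ∃ D : H →L[ℂ] H, ∀ x, ‖T x‖ ^ 2 + ‖D x‖ ^ 2 = ‖x‖ ^ 2 := by
  have hre : ∀ x, (inner ℂ ((1 - star T * T) x) x).re = ‖x‖ ^ 2 - ‖T x‖ ^ 2 := by
    intro x
    have h1 : inner ℂ ((star T * T) x) x = inner ℂ (T x) (T x) := by
      rw [ContinuousLinearMap.star_eq_adjoint, mul_apply_eq_comp,
        ContinuousLinearMap.adjoint_inner_left]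
    rw [sub_apply, inner_sub_left, h1, Complex.sub_re]
    congr 1
    · exact inner_self_eq_norm_sq (𝕜 := ℂ) x
    · exact inner_self_eq_norm_sq (𝕜 := ℂ) (T x)
  have hsa : IsSelfAdjoint (1 - star T * T) := .sub (.one _) (.star_mul_self T)
  have hpos : 0 ≤ 1 - star T * T := by
    rw [ContinuousLinearMap.nonneg_iff_isPositive]
    refine ⟨hsa.isSymmetric, fun x => ?_⟩
    change 0 ≤ (inner ℂ ((1 - star T * T) x) x).re
    rw [hre]
    have h1 : ‖T x‖ ≤ ‖x‖ := by simpa using T.le_of_opNorm_le hT x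
    nlinarith [norm_nonneg (T x)]
  refine ⟨CFC.sqrt (1 - star T * T), fun x => ?_⟩
  have h1 := CFC.sqrt_mul_sqrt_self (1 - star T * T) hpos
  have h2 : IsSelfAdjoint (CFC.sqrt (1 - star T * T)) := (CFC.sqrt_nonneg _).isSelfAdjoint
  generalize CFC.sqrt (1 - star T * T) = D at h1 h2
  have h3 : ‖D x‖ ^ 2 = (inner ℂ ((1 - star T * T) x) x).re := by
    rw [← h1, mul_apply_eq_comp, ← ContinuousLinearMap.adjoint_inner_right,
      ← ContinuousLinearMap.star_eq_adjoint, h2.star_eq]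
    exact (inner_self_eq_norm_sq (𝕜 := ℂ) (D x)).symm
  rw [h3, hre]
  ring

/-- A partial dilation: adding to `T x` the defect `D x`, moved into the orthogonal complement of `F
+ T F`, restores the norm and is invisible to inner products with `F`. -/
theorem exists_isometryEquiv_inner_eq (hH : ¬ FiniteDimensional ℂ H) (T : H →L[ℂ] H)
    (hT : ‖T‖ ≤ 1) (F : Submodule ℂ H) [FiniteDimensional ℂ F] :
    ∃ V : H ≃ₗᵢ[ℂ] H, ∀ x ∈ F, ∀ y ∈ F, inner ℂ y (V x) = inner ℂ y (T x) := by
  obtain ⟨D, hD⟩ := T.exists_defect hT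
  let G : Submodule ℂ H := F ⊔ F.map T.toLinearMap
  -- Extending the zero map on `⊥` merely yields some unitary from `H` onto `Gᗮ`.
  obtain ⟨J, -⟩ := LinearIsometry.exists_linearIsometryEquiv_extension (X := Gᗮ) hH
    (G.not_finiteDimensional_orthogonal hH) ⊥
    ⟨(0 : (⊥ : Submodule ℂ H) →ₗ[ℂ] Gᗮ), fun x => by simp [(Submodule.mem_bot ℂ).1 x.2]⟩
  have horth : ∀ g ∈ G, ∀ z, inner ℂ g (J z : H) = 0 := fun g hg z =>
    (Submodule.mem_orthogonal _ _).1 (J z).2 g hg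
  let B : H →ₗ[ℂ] H := T.toLinearMap + Gᗮ.subtype ∘ₗ J.toLinearEquiv.toLinearMap ∘ₗ D.toLinearMap
  have hB : ∀ x, B x = T x + J (D x) := fun x => rfl
  let φ : F →ₗᵢ[ℂ] H := ⟨B ∘ₗ F.subtype, fun x => by
    have h0 := horth (T x) (Submodule.mem_sup_right ⟨x, x.2, rfl⟩) (D x)
    have h1 := norm_add_sq_eq_norm_sq_add_norm_sq_of_inner_eq_zero _ _ h0
    have h2 := hD x
    have h3 : ‖(J (D x) : H)‖ = ‖D x‖ := J.norm_map _
    rw [h3] at h1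
    change ‖T x + J (D x)‖ = ‖(x : H)‖
    nlinarith [norm_nonneg (x : H), norm_nonneg (T x + (J (D x) : H))]⟩
  obtain ⟨V, hV⟩ := φ.exists_linearIsometryEquiv_extension hH hH F
  refine ⟨V, fun x hx y hy => ?_⟩
  have := hV ⟨x, hx⟩
  change V x = T x + J (D x) at this
  rw [this, inner_add_right, horth y (Submodule.mem_sup_left hy), add_zero]

end HilbertExtension

/-! ### Cyclic shift model and approximation of unitaries -/

section CyclicModel

/-- The cyclic shift on `Hᴺ`, twisted by a unimodular factor at the wrap-around. -/
noncomputable def twistedShift {H : Type*} [NormedAddCommGroup H] [InnerProductSpace ℂ H]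
    (n : ℕ) (μ : Circle) :
    PiLp 2 (fun _ : Fin (n + 1) => H) ≃ₗᵢ[ℂ] PiLp 2 (fun _ : Fin (n + 1) => H) :=
  (LinearIsometryEquiv.piLpCongrLeft 2 ℂ H (finRotate (n + 1))).trans
    (LinearIsometryEquiv.piLpCongrRight 2 fun k =>
      if k = 0 then
        { LinearEquiv.smulOfNeZero ℂ H (μ : ℂ) μ.coe_ne_zero with
          norm_map' := fun x => (norm_smul (μ : ℂ) x).trans (by rw [μ.norm_coe, one_mul]) }
      else LinearIsometryEquiv.refl ℂ H)

variable {H : Type*} [NormedAddCommGroup H] [InnerProductSpace ℂ H]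

theorem twistedShift_apply_zero (n : ℕ) (μ : Circle) (f : PiLp 2 (fun _ : Fin (n + 1) => H)) :
    twistedShift n μ f 0 = (μ : ℂ) • f (Fin.last n) := by
  have h : (finRotate (n + 1)).symm 0 = Fin.last n := by
    rw [Equiv.symm_apply_eq, finRotate_last]
  simp [twistedShift, Equiv.piCongrLeft', h, -finRotate_symm_apply]
  rfl

theorem twistedShift_apply_succ (n : ℕ) (μ : Circle) (f : PiLp 2 (fun _ : Fin (n + 1) => H))
    (k : Fin n) : twistedShift n μ f k.succ = f k.castSucc := by
  have h : (finRotate (n + 1)).symm k.succ = k.castSucc := by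
    rw [Equiv.symm_apply_eq, finRotate_apply]
    simp
  simp [twistedShift, Equiv.piCongrLeft', h, -finRotate_symm_apply]

/-- Content travels from slot `j` to slot `k`, collecting `μ` once if it wraps around. Taking `j =
k` and `m = n + 1` shows that the full power is the scalar `μ`. -/
theorem twistedShift_iterate_apply (n : ℕ) (μ : Circle) (f : PiLp 2 (fun _ : Fin (n + 1) => H))
    (m : ℕ) (j k : Fin (n + 1)) :
    ((j : ℕ) + m = k → ((twistedShift n μ)^[m] f) k = f j) ∧
      ((j : ℕ) + m = k + (n + 1) → ((twistedShift n μ)^[m] f) k = (μ : ℂ) • f j) := by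
  induction m generalizing k with
  | zero =>
    refine ⟨fun h => ?_, fun h => ?_⟩
    · rw [Function.iterate_zero, id, Fin.ext h]
    · omega
  | succ m ih =>
    rw [Function.iterate_succ_apply']
    induction k using Fin.cases with
    | zero =>
      refine ⟨fun h => ?_, fun h => ?_⟩
      · simp at h
      · rw [twistedShift_apply_zero, (ih (Fin.last n)).1 (by simp at h ⊢; omega)]
    | succ k =>
      rw [twistedShift_apply_succ]
      refine ⟨fun h => (ih _).1 ?_, fun h => (ih _).2 ?_⟩ <;> simp at h ⊢ <;> omega

/-- The isometric embedding `x ↦ L^{-1/2} (x, W⁻¹ x, …, W^{-(L-1)} x, 0, …, 0)`. -/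
noncomputable def orbitEmbedding (W : H ≃ₗᵢ[ℂ] H) {L n : ℕ} (hL : 0 < L) (hLn : L ≤ n) :
    H →ₗᵢ[ℂ] PiLp 2 (fun _ : Fin (n + 1) => H) where
  toFun x := WithLp.toLp 2 fun k =>
    if (k : ℕ) < L then ((√L : ℝ)⁻¹ : ℂ) • (W⁻¹ ^ (k : ℕ)) x else 0
  map_add' x y := by
    ext k
    by_cases h : (k : ℕ) < L <;> simp [h]
  map_smul' c x := by
    ext k
    by_cases h : (k : ℕ) < L <;> simp [h, smul_comm c]
  norm_map' x := by
    have hL' : (0 : ℝ) < L := by exact_mod_cast hL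
    have hcard : (Finset.univ.filter fun k : Fin (n + 1) => (k : ℕ) < L).card = L := by
      rw [Fin.card_filter_val_lt]
      omega
    have h : ∀ k : Fin (n + 1),
        ‖(if (k : ℕ) < L then ((√L : ℝ)⁻¹ : ℂ) • (W⁻¹ ^ (k : ℕ)) x else 0)‖ ^ 2 =
          if (k : ℕ) < L then ‖x‖ ^ 2 / L else 0 := by
      intro k
      split_ifs
      · rw [norm_smul, LinearIsometryEquiv.norm_map, mul_pow, norm_inv, Complex.norm_real,
          Real.norm_of_nonneg (Real.sqrt_nonneg _), inv_pow, Real.sq_sqrt hL'.le]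
        ring
      · simp
    rw [← sq_eq_sq₀ (norm_nonneg _) (norm_nonneg _)]
    change ‖WithLp.toLp 2 fun k : Fin (n + 1) =>
      if (k : ℕ) < L then ((√L : ℝ)⁻¹ : ℂ) • (W⁻¹ ^ (k : ℕ)) x else 0‖ ^ 2 = _
    rw [PiLp.norm_sq_eq_of_L2]
    simp only [h]
    rw [← Finset.sum_filter, Finset.sum_const, hcard, nsmul_eq_mul]
    field_simp

theorem orbitEmbedding_apply (W : H ≃ₗᵢ[ℂ] H) {L n : ℕ} (hL : 0 < L) (hLn : L ≤ n) (x : H)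
    (k : Fin (n + 1)) : orbitEmbedding W hL hLn x k =
      if (k : ℕ) < L then ((√L : ℝ)⁻¹ : ℂ) • (W⁻¹ ^ (k : ℕ)) x else 0 := rfl

/-- The two orbit segments overlap except in slots `0` and `L`, each contributing `‖x‖² / L`. Since
`L ≤ n`, the last slot is empty and the twist plays no role. -/
theorem norm_twistedShift_orbitEmbedding_sub_le (W : H ≃ₗᵢ[ℂ] H) {L n : ℕ} (hL : 0 < L)
    (hLn : L ≤ n) (μ : Circle) (x : H) :
    ‖twistedShift n μ (orbitEmbedding W hL hLn x) - orbitEmbedding W hL hLn (W x)‖ ≤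
      √(2 / L) * ‖x‖ := by
  have hL' : (0 : ℝ) < L := by exact_mod_cast hL
  have hnorm : ∀ y : H, ‖((√L : ℝ)⁻¹ : ℂ) • y‖ ^ 2 = ‖y‖ ^ 2 / L := by
    intro y
    rw [norm_smul, mul_pow, norm_inv, Complex.norm_real,
      Real.norm_of_nonneg (Real.sqrt_nonneg _), inv_pow, Real.sq_sqrt hL'.le]
    ring
  have key : ∀ k : Fin (n + 1),
      ‖(twistedShift n μ (orbitEmbedding W hL hLn x) - orbitEmbedding W hL hLn (W x)) k‖ ^ 2 ≤
        (if k = 0 then ‖x‖ ^ 2 / L else 0) +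
          (if k = ⟨L, by omega⟩ then ‖x‖ ^ 2 / L else 0) := by
    intro k
    have h0 : (0 : ℝ) ≤ ‖x‖ ^ 2 / L := by positivity
    rw [PiLp.sub_apply]
    induction k using Fin.cases with
    | zero =>
      rw [twistedShift_apply_zero, orbitEmbedding_apply, orbitEmbedding_apply,
        if_neg (by simpa using hLn), if_pos (by simpa using hL), smul_zero, zero_sub, norm_neg,
        hnorm, LinearIsometryEquiv.norm_map, LinearIsometryEquiv.norm_map, if_pos rfl]
      split_ifs <;> linarith
    | succ k =>
      rw [twistedShift_apply_succ, orbitEmbedding_apply, orbitEmbedding_apply, Fin.val_castSucc,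
        Fin.val_succ, if_neg (Fin.succ_ne_zero k), zero_add]
      rcases lt_trichotomy (k + 1 : ℕ) L with h | h | h
      · rw [if_pos (by omega), if_pos h]
        have : (W⁻¹ ^ (k + 1 : ℕ)) (W x) = (W⁻¹ ^ (k : ℕ)) x := by
          rw [pow_succ]
          change (W⁻¹ ^ (k : ℕ)) (W.symm (W x)) = _
          rw [W.symm_apply_apply]
        rw [this, sub_self, norm_zero]
        split_ifs <;> simp [h0]
      · rw [if_pos (by omega), if_neg (by omega), sub_zero, hnorm, LinearIsometryEquiv.norm_map,
          if_pos (Fin.ext (by simpa using h))]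
      · rw [if_neg (by omega), if_neg (by omega), sub_zero, norm_zero]
        split_ifs <;> simp [h0]
  refine le_of_sq_le_sq ?_ (by positivity)
  rw [PiLp.norm_sq_eq_of_L2, mul_pow, Real.sq_sqrt (by positivity)]
  refine (Finset.sum_le_sum fun k _ => key k).trans ?_
  rw [Finset.sum_add_distrib, Finset.sum_ite_eq', Finset.sum_ite_eq']
  simp only [Finset.mem_univ, if_true]
  apply le_of_eq
  ring

theorem inner_twistedShift_iterate_orbitEmbedding (W : H ≃ₗᵢ[ℂ] H) {L n : ℕ} (hL : 0 < L)
    (hLn : L ≤ n) (μ : Circle) (x y : H) {m : ℕ} (hm : L ≤ m) (hmn : m + L ≤ n + 1) :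
    inner ℂ ((twistedShift n μ)^[m] (orbitEmbedding W hL hLn x)) (orbitEmbedding W hL hLn y) =
      0 := by
  rw [PiLp.inner_apply]
  refine Finset.sum_eq_zero fun k _ => ?_
  rw [orbitEmbedding_apply W hL hLn y]
  split_ifs with h
  -- Slot `k < L` receives its content after wrapping, from slot `k + n + 1 - m ≥ L`, which is
  -- empty.
  · rw [((twistedShift_iterate_apply n μ _ m ⟨k + (n + 1) - m, by omega⟩ k).2
      (by simp only; omega)), orbitEmbedding_apply, if_neg (by simp only; omega), smul_zero,
      inner_zero_left]
  · rw [inner_zero_right]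

/-- Unitaries agreeing approximately with `W` on a finite-dimensional subspace, whose `N`-th power
is a prescribed unimodular scalar and whose intermediate powers map the subspace to its orthogonal
complement. -/
theorem LinearIsometryEquiv.exists_near_pow_eq_smul [CompleteSpace H]
    [TopologicalSpace.SeparableSpace H] (hH : ¬ FiniteDimensional ℂ H) (W : H ≃ₗᵢ[ℂ] H)
    (E : Submodule ℂ H) [FiniteDimensional ℂ E] (μ : Circle) {L N : ℕ} (hL : 0 < L)
    (hLN : L < N) :
    ∃ T : H ≃ₗᵢ[ℂ] H, (∀ x ∈ E, W x ∈ E → ‖T x - W x‖ ≤ √(2 / L) * ‖x‖) ∧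
      (∀ x, T^[N] x = (μ : ℂ) • x) ∧
      ∀ x ∈ E, ∀ y ∈ E, ∀ m, L ≤ m → m + L ≤ N → inner ℂ (T^[m] x) y = 0 := by
  obtain ⟨n, rfl⟩ : ∃ n, N = n + 1 := ⟨N - 1, by omega⟩
  have hLn : L ≤ n := by omega
  have hX : ¬ FiniteDimensional ℂ (PiLp 2 (fun _ : Fin (n + 1) => H)) := by
    intro h
    exact hH (FiniteDimensional.of_injective (orbitEmbedding W hL hLn).toLinearMap
      (orbitEmbedding W hL hLn).injective)
  have : SecondCountableTopology H := UniformSpace.secondCountable_of_separable H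
  -- The embedding is not onto, but its restriction to `E` extends to a unitary `Q`; the shift is
  -- then conjugated by `Q`.
  obtain ⟨Q, hQ⟩ := ((orbitEmbedding W hL hLn).comp
    E.subtypeₗᵢ).exists_linearIsometryEquiv_extension hH hX E
  have hQ' : ∀ x ∈ E, Q x = orbitEmbedding W hL hLn x := fun x hx => hQ ⟨x, hx⟩
  let T : H ≃ₗᵢ[ℂ] H := (Q.trans (twistedShift n μ)).trans Q.symm
  have hT : ∀ x m, T^[m] x = Q.symm ((twistedShift n μ)^[m] (Q x)) := by
    intro x m
    induction m with
    | zero => simp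
    | succ m ih => rw [Function.iterate_succ_apply', ih, Function.iterate_succ_apply']; simp [T]
  refine ⟨T, fun x hx hWx => ?_, fun x => ?_, fun x hx y hy m hm hmn => ?_⟩
  · rw [← Q.norm_map, map_sub, hQ' _ hWx]
    simpa [T, hQ' _ hx] using norm_twistedShift_orbitEmbedding_sub_le W hL hLn μ x
  · rw [hT, Q.symm_apply_eq, map_smul]
    ext k
    exact (twistedShift_iterate_apply n μ (Q x) (n + 1) k k).2 rfl
  · rw [hT, ← Q.inner_map_map, Q.apply_symm_apply, hQ' x hx, hQ' y hy]
    exact inner_twistedShift_iterate_orbitEmbedding W hL hLn μ x y hm hmn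

end CyclicModel

/-! ### Cesàro means and sets of density one -/

section Density

/-- Koopman–von Neumann: dominate the means by a decreasing null sequence `A` and keep the `n` with
`a n ≤ √(A n)`. By Markov's inequality at most `N √(A N)` indices up to `N` are lost. -/
theorem exists_strictMono_hasNatDensity_one_of_cesaro {a : ℕ → ℝ} (ha : ∀ n, 0 ≤ a n)
    (h : Tendsto (fun K : ℕ => (∑ n ∈ Finset.Icc 1 K, a n) / K) atTop (𝓝 0)) :
    ∃ n : ℕ → ℕ, StrictMono n ∧ HasNatDensity (Set.range n) 1 ∧
      Tendsto (fun j => a (n j)) atTop (𝓝 0) := by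
  classical
  set c : ℕ → ℝ := fun K => (∑ n ∈ Finset.Icc 1 K, a n) / K with hc
  have hc0 : ∀ K, 0 ≤ c K := fun K =>
    div_nonneg (Finset.sum_nonneg fun n _ => ha n) (Nat.cast_nonneg K)
  have hbdd : ∀ N, BddAbove (Set.range fun M => c (N + M)) := fun N =>
    h.bddAbove_range.mono (by rintro _ ⟨M, rfl⟩; exact ⟨N + M, rfl⟩)
  -- The supremum over the tail gives monotonicity; the added term keeps `A` positive, so that `√(A
  -- N)` can be cancelled.
  set A : ℕ → ℝ := fun N => (⨆ M, c (N + M)) + 1 / ((N : ℝ) + 1) with hA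
  have hcA : ∀ N, c N ≤ A N := fun N => by
    have h1 : c (N + 0) ≤ ⨆ M, c (N + M) := le_ciSup (hbdd N) 0
    have h2 : (0 : ℝ) ≤ 1 / ((N : ℝ) + 1) := by positivity
    simp only [hA]
    linarith [show c (N + 0) = c N from rfl]
  have hApos : ∀ N, 0 < A N := fun N => by
    have h1 : c (N + 0) ≤ ⨆ M, c (N + M) := le_ciSup (hbdd N) 0
    have h2 : (0 : ℝ) < 1 / ((N : ℝ) + 1) := by positivity
    simp only [hA]
    linarith [hc0 (N + 0)]
  have hanti : ∀ N N', N ≤ N' → A N' ≤ A N := by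
    intro N N' hNN
    refine add_le_add (ciSup_le fun M => ?_) ?_
    · have := le_ciSup (hbdd N) (N' - N + M)
      rwa [← add_assoc, Nat.add_sub_cancel' hNN] at this
    · have : (N : ℝ) ≤ N' := by exact_mod_cast hNN
      gcongr
  have hA0 : Tendsto A atTop (𝓝 0) := by
    have h1 : Tendsto (fun N => ⨆ M, c (N + M)) atTop (𝓝 0) := by
      rw [Metric.tendsto_atTop]
      intro ε hε
      obtain ⟨N, hN⟩ := Metric.tendsto_atTop.1 h (ε / 2) (by positivity)
      refine ⟨N, fun n hn => ?_⟩
      have h2 : ⨆ M, c (n + M) ≤ ε / 2 := ciSup_le fun M => by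
        have := hN (n + M) (by omega)
        rw [Real.dist_eq, sub_zero] at this
        exact (le_abs_self _).trans this.le
      have h3 : 0 ≤ ⨆ M, c (n + M) := Real.iSup_nonneg fun M => hc0 _
      rw [Real.dist_eq, sub_zero, abs_of_nonneg h3]
      linarith
    have h2 := h1.add (tendsto_one_div_add_atTop_nhds_zero_nat (𝕜 := ℝ))
    rwa [add_zero] at h2
  have hsA : Tendsto (fun N => √(A N)) atTop (𝓝 0) := by
    simpa using hA0.sqrt
  set J : Set ℕ := {n | a n ≤ √(A n)} with hJ
  have hbad : ∀ N : ℕ, ((Finset.Icc 1 N).filter fun n => ¬ n ∈ J).card ≤ N * √(A N) := by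
    intro N
    have hs : 0 < √(A N) := Real.sqrt_pos.2 (hApos N)
    have h1 : (((Finset.Icc 1 N).filter fun n => ¬ n ∈ J).card : ℝ) * √(A N) ≤
        ∑ n ∈ Finset.Icc 1 N, a n := by
      rw [← nsmul_eq_mul]
      refine (Finset.card_nsmul_le_sum _ a _ fun n hn => ?_).trans
        (Finset.sum_le_sum_of_subset_of_nonneg (Finset.filter_subset _ _) fun n _ _ => ha n)
      rw [Finset.mem_filter, Finset.mem_Icc] at hn
      have h2 : √(A n) < a n := not_le.1 hn.2
      exact (Real.sqrt_le_sqrt (hanti n N hn.1.2)).trans h2.le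
    have h2 : ∑ n ∈ Finset.Icc 1 N, a n ≤ N * A N := by
      rcases Nat.eq_zero_or_pos N with rfl | hN
      · simp
      · have := hcA N
        rwa [hc, div_le_iff₀ (by exact_mod_cast hN), mul_comm] at this
    have h3 : (N : ℝ) * A N = N * √(A N) * √(A N) := by
      rw [mul_assoc, Real.mul_self_sqrt (hApos N).le]
    exact le_of_mul_le_mul_right ((h1.trans h2).trans h3.le) hs
  have hcard : ∀ N : ℕ, ((J ∩ Set.Icc 1 N).ncard : ℝ) +
      ((Finset.Icc 1 N).filter fun n => ¬ n ∈ J).card = N := by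
    intro N
    have h1 : J ∩ Set.Icc 1 N = ((Finset.Icc 1 N).filter fun n => n ∈ J : Finset ℕ) := by
      ext n
      simp [and_comm]
    rw [h1, Set.ncard_coe_finset]
    have h2 := Finset.card_filter_add_card_filter_not (s := Finset.Icc 1 N) (fun n => n ∈ J)
    rw [Nat.card_Icc, Nat.add_sub_cancel] at h2
    exact_mod_cast h2
  have hdens : HasNatDensity J 1 := by
    have h1 : Tendsto (fun N => 1 - √(A N)) atTop (𝓝 1) := by
      simpa using tendsto_const_nhds.sub hsA
    refine tendsto_of_tendsto_of_tendsto_of_le_of_le' h1 tendsto_const_nhds ?_ ?_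
    · filter_upwards [eventually_gt_atTop 0] with N hN
      have hN' : (0 : ℝ) < N := by exact_mod_cast hN
      rw [le_div_iff₀ hN']
      linarith [hcard N, hbad N]
    · filter_upwards [eventually_gt_atTop 0] with N hN
      have hN' : (0 : ℝ) < N := by exact_mod_cast hN
      rw [div_le_one hN', ← hcard N]
      exact le_add_of_nonneg_right (Nat.cast_nonneg _)
  have hinf : J.Infinite := by
    intro hfin
    have h1 : Tendsto (fun N : ℕ => ((J ∩ Set.Icc 1 N).ncard : ℝ) / N) atTop (𝓝 0) := by
      refine squeeze_zero (fun N => by positivity) (fun N => ?_)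
        (tendsto_const_div_atTop_nhds_zero_nat (J.ncard : ℝ))
      gcongr
      exact Set.inter_subset_left
    exact one_ne_zero (tendsto_nhds_unique hdens h1)
  have hmono := Nat.nth_strictMono (p := fun n => n ∈ J) hinf
  refine ⟨Nat.nth fun n => n ∈ J, hmono, ?_, ?_⟩
  · rw [Nat.range_nth_of_infinite (p := fun n => n ∈ J) hinf]
    exact hdens
  · exact squeeze_zero (fun j => ha _) (fun j => Nat.nth_mem_of_infinite hinf j)
      (hsA.comp hmono.tendsto_atTop)

/-- One weighted sum of all the sequences replaces a diagonal argument: its means vanish by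
dominated convergence, and it dominates a positive multiple of each sequence. -/
theorem exists_common_strictMono_hasNatDensity_one {u : ℕ → ℕ → ℝ} {C : ℕ → ℝ}
    (hu : ∀ p n, 0 ≤ u p n) (huC : ∀ p n, u p n ≤ C p)
    (h : ∀ p, Tendsto (fun K : ℕ => (∑ n ∈ Finset.Icc 1 K, u p n) / K) atTop (𝓝 0)) :
    ∃ n : ℕ → ℕ, StrictMono n ∧ HasNatDensity (Set.range n) 1 ∧
      ∀ p, Tendsto (fun j => u p (n j)) atTop (𝓝 0) := by
  have hC : ∀ p, 0 ≤ C p := fun p => (hu p 0).trans (huC p 0)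
  set w : ℕ → ℝ := fun p => (1 / 2) ^ p / (1 + C p) with hw
  have hwpos : ∀ p, 0 < w p := fun p => by
    have := hC p
    positivity
  have hwC : ∀ p, w p * C p ≤ (1 / 2) ^ p := fun p => by
    have := hC p
    rw [hw, div_mul_eq_mul_div, div_le_iff₀ (by positivity)]
    gcongr
    linarith
  have hbound : ∀ p n, w p * u p n ≤ (1 / 2) ^ p := fun p n =>
    (mul_le_mul_of_nonneg_left (huC p n) (hwpos p).le).trans (hwC p)
  have hnn : ∀ p n, 0 ≤ w p * u p n := fun p n => mul_nonneg (hwpos p).le (hu p n)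
  have hsum : ∀ n, Summable fun p => w p * u p n := fun n =>
    Summable.of_nonneg_of_le (fun p => hnn p n) (fun p => hbound p n) summable_geometric_two
  have hces : Tendsto (fun K : ℕ => (∑ n ∈ Finset.Icc 1 K, ∑' p, w p * u p n) / K) atTop
      (𝓝 0) := by
    have h1 : ∀ K : ℕ, (∑ n ∈ Finset.Icc 1 K, ∑' p, w p * u p n) / K =
        ∑' p, w p * ((∑ n ∈ Finset.Icc 1 K, u p n) / K) := by
      intro K
      rw [← Summable.tsum_finsetSum fun n _ => hsum n, ← tsum_div_const]
      congr 1
      ext p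
      rw [← Finset.mul_sum, mul_div_assoc]
    simp only [h1]
    have h2 := tendsto_tsum_of_dominated_convergence (𝓕 := atTop)
      (f := fun (K : ℕ) p => w p * ((∑ n ∈ Finset.Icc 1 K, u p n) / K)) (g := fun _ => 0)
      (bound := fun p : ℕ => ((1 : ℝ) / 2) ^ p) summable_geometric_two
      (fun p => by simpa using (h p).const_mul (w p)) (Eventually.of_forall fun K p => ?_)
    · simpa using h2
    · have h3 : 0 ≤ (∑ n ∈ Finset.Icc 1 K, u p n) / K :=
        div_nonneg (Finset.sum_nonneg fun n _ => hu p n) (Nat.cast_nonneg K)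
      rw [Real.norm_of_nonneg (mul_nonneg (hwpos p).le h3)]
      refine le_trans (mul_le_mul_of_nonneg_left ?_ (hwpos p).le) (hwC p)
      refine div_le_of_le_mul₀ (Nat.cast_nonneg K) (hC p) ?_
      refine (Finset.sum_le_card_nsmul _ _ _ fun n _ => huC p n).trans ?_
      simp [mul_comm]
  obtain ⟨n, hn, hd, ht⟩ := exists_strictMono_hasNatDensity_one_of_cesaro
    (fun n => tsum_nonneg fun p => hnn p n) hces
  refine ⟨n, hn, hd, fun p => ?_⟩
  refine squeeze_zero (fun j => hu p _) (fun j => ?_) (by simpa using ht.const_mul (w p)⁻¹)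
  rw [le_inv_mul_iff₀ (hwpos p)]
  exact (hsum (n j)).le_tsum p fun q _ => hnn q _

theorem sum_range_le_of_block_le {a : ℕ → ℝ} (ha : ∀ n, 0 ≤ a n) {N : ℕ} (hN : 0 < N) {ε : ℝ}
    (hε : 0 ≤ ε) (h : ∀ M, ∑ n ∈ Finset.range N, a (M + n) ≤ N * ε) (K : ℕ) :
    ∑ n ∈ Finset.range K, a n ≤ (K + N) * ε := by
  have h1 : ∀ q : ℕ, ∑ n ∈ Finset.range (N * q), a n ≤ (N * q : ℕ) * ε := by
    intro q
    induction q with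
    | zero => simp
    | succ q ih =>
      rw [Nat.mul_succ, Finset.sum_range_add]
      push_cast at ih ⊢
      linarith [h (N * q)]
  have h2 : K ≤ N * (K / N + 1) := (Nat.lt_mul_div_succ K hN).le
  have h3 : N * (K / N + 1) ≤ K + N := by
    rw [Nat.mul_succ]
    exact Nat.add_le_add_right (Nat.mul_div_le K N) N
  calc ∑ n ∈ Finset.range K, a n ≤ ∑ n ∈ Finset.range (N * (K / N + 1)), a n :=
        Finset.sum_le_sum_of_subset_of_nonneg (Finset.range_mono h2) fun n _ _ => ha n
    _ ≤ (N * (K / N + 1) : ℕ) * ε := h1 _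
    _ ≤ (K + N) * ε := by
        gcongr
        exact_mod_cast h3

theorem tendsto_cesaro_of_block_le {a : ℕ → ℝ} (ha : ∀ n, 0 ≤ a n)
    (h : ∀ ε > 0, ∃ N : ℕ, 0 < N ∧ ∀ M, ∑ n ∈ Finset.range N, a (M + n) ≤ N * ε) :
    Tendsto (fun K : ℕ => (∑ n ∈ Finset.Icc 1 K, a n) / K) atTop (𝓝 0) := by
  rw [Metric.tendsto_atTop]
  intro ε hε
  -- For `K ≥ N + 1` the block bound is `(K + 1 + N) ε / 3 ≤ 2 K ε / 3`.
  obtain ⟨N, hN, hNM⟩ := h (ε / 3) (by positivity)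
  refine ⟨N + 1, fun K hK => ?_⟩
  have hK0 : (0 : ℝ) < K := by exact_mod_cast (by omega : 0 < K)
  have hKN : (N : ℝ) + 1 ≤ K := by exact_mod_cast hK
  have h0 : 0 ≤ ∑ n ∈ Finset.Icc 1 K, a n := Finset.sum_nonneg fun n _ => ha n
  rw [Real.dist_eq, sub_zero, abs_of_nonneg (by positivity), div_lt_iff₀ hK0]
  have h1 : ∑ n ∈ Finset.Icc 1 K, a n ≤ ∑ n ∈ Finset.range (K + 1), a n :=
    Finset.sum_le_sum_of_subset_of_nonneg
      (fun n hn => Finset.mem_range.2 (Nat.lt_succ_of_le (Finset.mem_Icc.1 hn).2))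
      fun n _ _ => ha n
  have h2 := sum_range_le_of_block_le ha hN (by positivity) hNM (K + 1)
  push_cast at h2
  nlinarith

end Density

/-! ### Bessel-type inequality and averaged orthogonality -/

section Bessel

variable {H : Type*} [NormedAddCommGroup H] [InnerProductSpace ℂ H]

/-- A Bessel-type inequality for a family that is orthogonal on average. -/
theorem sq_sum_norm_inner_sq_le {ι : Type*} (s : Finset ι) (v : ι → H) (y : H) :
    (∑ i ∈ s, ‖inner ℂ (v i) y‖ ^ 2) ^ 2 ≤
      (∑ i ∈ s, ∑ j ∈ s, ‖inner ℂ (v i) (v j)‖ ^ 2) * ‖y‖ ^ 4 := by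
  set c : ι → ℂ := fun i => inner ℂ (v i) y with hc
  set S : ℝ := ∑ i ∈ s, ‖c i‖ ^ 2 with hS
  set G : ℝ := ∑ i ∈ s, ∑ j ∈ s, ‖inner ℂ (v i) (v j)‖ ^ 2 with hG
  -- Duality: `⟨Z, y⟩ = S` gives `S ≤ ‖Z‖ ‖y‖`, while Cauchy–Schwarz over pairs gives `‖Z‖⁴ ≤ S² G`;
  -- then `S²` is cancelled.
  set Z : H := ∑ i ∈ s, c i • v i with hZ
  have hS0 : 0 ≤ S := Finset.sum_nonneg fun i _ => by positivity
  have hG0 : 0 ≤ G := Finset.sum_nonneg fun i _ => Finset.sum_nonneg fun j _ => by positivity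
  have h1 : inner ℂ Z y = (S : ℂ) := by
    rw [hZ, sum_inner, hS, Complex.ofReal_sum]
    refine Finset.sum_congr rfl fun i _ => ?_
    rw [inner_smul_left, RCLike.conj_mul]
    simp
  have h2 : S ≤ ‖Z‖ * ‖y‖ := by
    have := norm_inner_le_norm (𝕜 := ℂ) Z y
    rwa [h1, Complex.norm_real, Real.norm_of_nonneg hS0] at this
  have h3 : ‖Z‖ ^ 2 ≤ ∑ p ∈ s ×ˢ s, (‖c p.1‖ * ‖c p.2‖) * ‖inner ℂ (v p.1) (v p.2)‖ := by
    have h4 : ((‖Z‖ ^ 2 : ℝ) : ℂ) = ∑ p ∈ s ×ˢ s,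
        (starRingEnd ℂ (c p.1) * (c p.2 * inner ℂ (v p.1) (v p.2))) := by
      rw [Complex.ofReal_pow]
      refine (inner_self_eq_norm_sq_to_K (𝕜 := ℂ) Z).symm.trans ?_
      rw [hZ, sum_inner, Finset.sum_product]
      refine Finset.sum_congr rfl fun i _ => ?_
      rw [inner_smul_left, inner_sum, Finset.mul_sum]
      refine Finset.sum_congr rfl fun j _ => ?_
      rw [inner_smul_right]
    have h5 : ‖Z‖ ^ 2 = ‖((‖Z‖ ^ 2 : ℝ) : ℂ)‖ := by
      rw [Complex.norm_real, Real.norm_of_nonneg (by positivity)]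
    rw [h5, h4]
    refine (norm_sum_le _ _).trans (Finset.sum_le_sum fun p _ => ?_)
    rw [norm_mul, norm_mul, RCLike.norm_conj, mul_assoc]
  have h4 : (‖Z‖ ^ 2) ^ 2 ≤ S ^ 2 * G := by
    refine (pow_le_pow_left₀ (by positivity) h3 2).trans ?_
    refine (Finset.sum_mul_sq_le_sq_mul_sq _ _ _).trans (le_of_eq ?_)
    congr 1
    · rw [hS, sq, Finset.sum_mul_sum, Finset.sum_product]
      exact Finset.sum_congr rfl fun i _ => Finset.sum_congr rfl fun j _ => mul_pow _ _ _
    · rw [Finset.sum_product]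
  clear_value S G
  rcases hS0.eq_or_lt with h0 | hpos
  · rw [← h0, zero_pow two_ne_zero]
    exact mul_nonneg hG0 (by positivity)
  · have h5 : S ^ 4 ≤ (‖Z‖ * ‖y‖) ^ 4 := pow_le_pow_left₀ hS0 h2 4
    have h6 : S ^ 2 * S ^ 2 ≤ S ^ 2 * (G * ‖y‖ ^ 4) := by
      calc S ^ 2 * S ^ 2 = S ^ 4 := by ring
        _ ≤ (‖Z‖ * ‖y‖) ^ 4 := h5
        _ = (‖Z‖ ^ 2) ^ 2 * ‖y‖ ^ 4 := by ring
        _ ≤ S ^ 2 * G * ‖y‖ ^ 4 := by gcongr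
        _ = S ^ 2 * (G * ‖y‖ ^ 4) := by ring
    exact le_of_mul_le_mul_left h6 (pow_pos hpos 2)

theorem norm_pow_apply_of_isometry {T : H →L[ℂ] H} (hT : ∀ x, ‖T x‖ = ‖x‖) (n : ℕ) (x : H) :
    ‖(T ^ n) x‖ = ‖x‖ := by
  induction n with
  | zero => rfl
  | succ n ih => rw [pow_succ', mul_apply_eq_comp, hT, ih]

theorem inner_pow_apply_of_isometry {T : H →L[ℂ] H} (hT : ∀ x, ‖T x‖ = ‖x‖) (n : ℕ) (x y : H) :
    inner ℂ ((T ^ n) x) ((T ^ n) y) = inner ℂ x y :=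
  (LinearMap.norm_map_iff_inner_map_map (T ^ n)).1 (norm_pow_apply_of_isometry hT n) x y

/-- An isometry preserves Gram matrices along the orbit, so one good `N` controls every block of
length `N`, wherever it starts. -/
theorem tendsto_cesaro_norm_inner_sq {T : H →L[ℂ] H} (hT : ∀ x, ‖T x‖ = ‖x‖) {x : H}
    (hx : ∀ ε > 0, ∃ N : ℕ, 0 < N ∧ ∑ n ∈ Finset.range N, ∑ m ∈ Finset.range N,
      ‖inner ℂ ((T ^ n) x) ((T ^ m) x)‖ ^ 2 ≤ (N : ℝ) ^ 2 * ε) (y : H) :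
    Tendsto (fun K : ℕ => (∑ n ∈ Finset.Icc 1 K, ‖inner ℂ ((T ^ n) x) y‖ ^ 2) / K) atTop
      (𝓝 0) := by
  refine tendsto_cesaro_of_block_le (fun n => by positivity) fun δ hδ => ?_
  obtain ⟨N, hN, hG⟩ := hx ((δ / (‖y‖ ^ 2 + 1)) ^ 2) (by positivity)
  refine ⟨N, hN, fun M => ?_⟩
  refine le_of_sq_le_sq ?_ (by positivity)
  refine (sq_sum_norm_inner_sq_le _ _ _).trans ?_
  have h1 : ∀ n m, inner ℂ ((T ^ (M + n)) x) ((T ^ (M + m)) x) =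
      inner ℂ ((T ^ n) x) ((T ^ m) x) := fun n m => by
    rw [pow_add, pow_add, mul_apply_eq_comp, mul_apply_eq_comp, inner_pow_apply_of_isometry hT]
  simp only [h1]
  calc _ ≤ (N : ℝ) ^ 2 * (δ / (‖y‖ ^ 2 + 1)) ^ 2 * ‖y‖ ^ 4 := by gcongr
    _ = (N * δ) ^ 2 * (‖y‖ ^ 2 / (‖y‖ ^ 2 + 1)) ^ 2 := by field_simp
    _ ≤ (N * δ) ^ 2 * 1 ^ 2 := by
        gcongr
        rw [div_le_one (by positivity)]
        linarith
    _ = (N * δ) ^ 2 := by ring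

theorem LinearIsometryEquiv.coe_pow_apply (V : H ≃ₗᵢ[ℂ] H) (n : ℕ) (x : H) :
    ((V : H →L[ℂ] H) ^ n) x = V^[n] x := by
  induction n with
  | zero => rfl
  | succ n ih => rw [pow_succ', mul_apply_eq_comp, ih, Function.iterate_succ_apply']; rfl

theorem inner_pow_apply_eq_zero_of_isometry {T : H →L[ℂ] H} (hT : ∀ x, ‖T x‖ = ‖x‖) {x : H}
    {L M : ℕ} (h : ∀ m, L ≤ m → m < M → inner ℂ ((T ^ m) x) x = 0) {n m : ℕ} (hn : n < M)
    (hm : m < M) (hnm : n + L ≤ m ∨ m + L ≤ n) : inner ℂ ((T ^ n) x) ((T ^ m) x) = 0 := by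
  have key : ∀ a b, b < M → a + L ≤ b → inner ℂ ((T ^ b) x) ((T ^ a) x) = 0 := by
    intro a b hb hab
    obtain ⟨c, rfl⟩ : ∃ c, b = a + c := ⟨b - a, by omega⟩
    rw [pow_add, mul_apply_eq_comp, inner_pow_apply_of_isometry hT]
    exact h c (by omega) (by omega)
  rcases hnm with h1 | h1
  · rw [← inner_conj_symm, key n m hm h1, map_zero]
  · exact key m n hn h1

/-- The Gram matrix is banded: each row has at most `2L` nonzero entries, of squared modulus at most
`‖x‖⁴`. -/
theorem sum_sum_norm_inner_sq_le_of_isometry {T : H →L[ℂ] H} (hT : ∀ x, ‖T x‖ = ‖x‖) {x : H}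
    {L M : ℕ} (h : ∀ m, L ≤ m → m < M → inner ℂ ((T ^ m) x) x = 0) :
    ∑ n ∈ Finset.range M, ∑ m ∈ Finset.range M, ‖inner ℂ ((T ^ n) x) ((T ^ m) x)‖ ^ 2 ≤
      M * (2 * L * ‖x‖ ^ 4) := by
  refine (Finset.sum_le_card_nsmul _ _ (2 * L * ‖x‖ ^ 4) fun n hn => ?_).trans_eq
    (by rw [Finset.card_range, nsmul_eq_mul])
  calc ∑ m ∈ Finset.range M, ‖inner ℂ ((T ^ n) x) ((T ^ m) x)‖ ^ 2
      ≤ ∑ m ∈ Finset.range M, if m ∈ Finset.Ico (n + 1 - L) (n + L) then ‖x‖ ^ 4 else 0 := by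
        refine Finset.sum_le_sum fun m hm => ?_
        split_ifs with hnm
        · have h1 := norm_inner_le_norm (𝕜 := ℂ) ((T ^ n) x) ((T ^ m) x)
          rw [norm_pow_apply_of_isometry hT, norm_pow_apply_of_isometry hT] at h1
          calc _ ≤ (‖x‖ * ‖x‖) ^ 2 := by gcongr
            _ = ‖x‖ ^ 4 := by ring
        · rw [Finset.mem_Ico] at hnm
          rw [inner_pow_apply_eq_zero_of_isometry hT h (Finset.mem_range.1 hn)
            (Finset.mem_range.1 hm) (by omega)]
          simp
    _ = ((Finset.range M).filter fun m => m ∈ Finset.Ico (n + 1 - L) (n + L)).card • ‖x‖ ^ 4 := by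
        rw [← Finset.sum_filter, Finset.sum_const]
    _ ≤ (2 * L) • ‖x‖ ^ 4 := by
        refine nsmul_le_nsmul_left (by positivity) ?_
        calc _ ≤ (Finset.Ico (n + 1 - L) (n + L)).card :=
              Finset.card_le_card fun m hm => (Finset.mem_filter.1 hm).2
          _ ≤ 2 * L := by
              rw [Nat.card_Ico]
              omega
    _ = 2 * L * ‖x‖ ^ 4 := by
        rw [nsmul_eq_mul]
        push_cast
        ring

end Bessel

/-! ### A Baire category criterion -/

section Residual

/-- The sets `G i` cut `U` out of `A`. Each `P k` is open only relative to `U`; an open set of `X`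
with the same trace on `U` is dense in `A`, because `U` is. -/
theorem isResidualIn_of_dense_subset {X : Type*} {t : TopologicalSpace X} {A U S : Set X}
    {ι κ : Type*} [Countable ι] [Countable κ] (hUA : U ⊆ A) (hdense : A ⊆ @closure X t U)
    {G : ι → Set X} (hG : ∀ i, IsOpen[t] (G i)) (hUG : ∀ i, U ⊆ G i)
    (hGU : ∀ a ∈ A, (∀ i, a ∈ G i) → a ∈ U) {P : κ → Set X}
    (hP : ∀ k, @IsOpen U (t.induced Subtype.val) (Subtype.val ⁻¹' P k))
    (hPd : ∀ k, U ⊆ @closure X t (U ∩ P k)) (hS : ∀ a ∈ U, (∀ k, a ∈ P k) → a ∈ S) :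
    IsResidualIn t A S := by
  have hd : ∀ O : Set X, A ⊆ closure (A ∩ O) → Dense (Subtype.val ⁻¹' O : Set A) := by
    intro O hO
    rw [Subtype.dense_iff]
    refine hO.trans (closure_mono ?_)
    rintro a ⟨ha, haO⟩
    exact ⟨⟨a, ha⟩, haO, rfl⟩
  have hGr : ∀ i, (Subtype.val ⁻¹' G i : Set A) ∈ residual A := fun i =>
    residual_of_dense_open ((hG i).preimage continuous_subtype_val)
      (hd _ (hdense.trans (closure_mono fun u hu => ⟨hUA hu, hUG i hu⟩)))
  have hPr : ∀ k, ∃ O : Set X, (∀ u ∈ U, u ∈ O → u ∈ P k) ∧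
      (Subtype.val ⁻¹' O : Set A) ∈ residual A := by
    intro k
    obtain ⟨O, hO, hOP⟩ := isOpen_induced_iff.1 (hP k)
    have hOP' : ∀ u ∈ U, (u ∈ O ↔ u ∈ P k) := fun u hu =>
      Set.ext_iff.1 hOP ⟨u, hu⟩
    refine ⟨O, fun u hu => (hOP' u hu).1, residual_of_dense_open
      (hO.preimage continuous_subtype_val) (hd _ ?_)⟩
    have h1 : U ⊆ closure (A ∩ O) := (hPd k).trans
      (closure_mono fun u hu => ⟨hUA hu.1, (hOP' u hu.1).2 hu.2⟩)
    exact hdense.trans (closure_minimal h1 isClosed_closure)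
  choose O hO hOr using hPr
  change (Subtype.val ⁻¹' S : Set A) ∈ residual A
  filter_upwards [countable_iInter_mem.2 hGr, countable_iInter_mem.2 hOr] with a haG haO
  have haU : (a : X) ∈ U := hGU a a.2 fun i => Set.mem_iInter.1 haG i
  exact hS a haU fun k => hO k a haU (Set.mem_iInter.1 haO k)

end Residual

/-! ### Operator topologies on contractions and unitaries -/

section Topologies

variable {H : Type*} [NormedAddCommGroup H] [InnerProductSpace ℂ H]

theorem tendsto_strongOperatorTopology_iff {α : Type*} {l : Filter α} {f : α → H →L[ℂ] H}
    {T : H →L[ℂ] H} : Tendsto f l (@nhds _ (strongOperatorTopology H) T) ↔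
      ∀ x, Tendsto (fun a => f a x) l (𝓝 (T x)) := by
  rw [nhds_induced, tendsto_comap_iff, tendsto_pi_nhds]
  rfl

theorem tendsto_weakOperatorTopology_iff [CompleteSpace H] {α : Type*} {l : Filter α}
    {f : α → H →L[ℂ] H}
    {T : H →L[ℂ] H} : Tendsto f l (@nhds _ (weakOperatorTopology H) T) ↔
      ∀ x y, Tendsto (fun a => inner ℂ y (f a x)) l (𝓝 (inner ℂ y (T x))) := by
  rw [nhds_induced, tendsto_comap_iff,
    ContinuousLinearMapWOT.tendsto_iff_forall_inner_apply_tendsto]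
  rfl

theorem tendsto_strongStarOperatorTopology_iff [CompleteSpace H] {α : Type*} {l : Filter α}
    {f : α → H →L[ℂ] H} {T : H →L[ℂ] H} :
    Tendsto f l (@nhds _ (strongStarOperatorTopology H) T) ↔
      (∀ x, Tendsto (fun a => f a x) l (𝓝 (T x))) ∧
        ∀ x, Tendsto (fun a => ContinuousLinearMap.adjoint (f a) x) l
          (𝓝 (ContinuousLinearMap.adjoint T x)) := by
  have h1 : @nhds _ (strongStarOperatorTopology H) T = @nhds _ (strongOperatorTopology H) T ⊓
      @nhds _ ((strongOperatorTopology H).induced fun T => ContinuousLinearMap.adjoint T) T :=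
    nhds_inf (t₁ := strongOperatorTopology H)
      (t₂ := (strongOperatorTopology H).induced fun T => ContinuousLinearMap.adjoint T)
  have h2 : @nhds _ ((strongOperatorTopology H).induced fun T => ContinuousLinearMap.adjoint T) T =
      comap (fun T => ContinuousLinearMap.adjoint T)
        (@nhds _ (strongOperatorTopology H) (ContinuousLinearMap.adjoint T)) :=
    @nhds_induced _ _ (strongOperatorTopology H) _ T
  rw [h1, h2, tendsto_inf, tendsto_strongOperatorTopology_iff, tendsto_comap_iff,
    tendsto_strongOperatorTopology_iff]
  rfl

theorem strongOperatorTopology_le_weak [CompleteSpace H] :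
    strongOperatorTopology H ≤ weakOperatorTopology H := by
  refine le_iff_nhds _ _ |>.2 fun T => ?_
  change Tendsto id _ _
  rw [tendsto_weakOperatorTopology_iff]
  intro x y
  exact tendsto_const_nhds.inner (tendsto_strongOperatorTopology_iff.1 tendsto_id x)

theorem continuous_inner_apply_weak [CompleteSpace H] (x y : H) :
    @Continuous (H →L[ℂ] H) ℂ (weakOperatorTopology H) _ fun T => inner ℂ y (T x) := by
  let _ := weakOperatorTopology H
  exact continuous_iff_continuousAt.2 fun T =>
    (tendsto_weakOperatorTopology_iff (l := 𝓝 T) (f := id)).1 tendsto_id x y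

theorem continuous_apply_strong (x : H) :
    @Continuous (H →L[ℂ] H) H (strongOperatorTopology H) _ fun T => T x := by
  let _ := strongOperatorTopology H
  exact continuous_iff_continuousAt.2 fun T =>
    (tendsto_strongOperatorTopology_iff (l := 𝓝 T) (f := id)).1 tendsto_id x

/-- Weak lower semicontinuity: `‖T x‖` is the supremum of `|⟨y, T x⟩|` over the unit ball. -/
theorem isOpen_lt_norm_apply_weak [CompleteSpace H] (x : H) (c : ℝ) :
    IsOpen[weakOperatorTopology H] {T : H →L[ℂ] H | c < ‖T x‖} := by
  let _ := weakOperatorTopology H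
  have h1 : {T : H →L[ℂ] H | c < ‖T x‖} =
      ⋃ y ∈ Metric.closedBall (0 : H) 1, {T : H →L[ℂ] H | c < ‖inner ℂ y (T x)‖} := by
    ext T
    simp only [Set.mem_iUnion, Set.mem_ofPred_eq, mem_closedBall_zero_iff, exists_prop]
    refine ⟨fun h => ?_, fun ⟨y, hy, h⟩ => ?_⟩
    · by_cases h0 : T x = 0
      · refine ⟨0, by simp, ?_⟩
        simpa [h0] using h
      · refine ⟨((‖T x‖⁻¹ : ℝ) : ℂ) • T x, ?_, ?_⟩
        · rw [norm_smul, Complex.norm_real, norm_inv, norm_norm,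
            inv_mul_cancel₀ (norm_ne_zero_iff.2 h0)]
        · rw [inner_smul_left, norm_mul, RCLike.norm_conj, Complex.norm_real, norm_inv, norm_norm,
            inner_self_eq_norm_sq_to_K, norm_pow]
          have : ‖((‖T x‖ : ℝ) : ℂ)‖ = ‖T x‖ := by simp
          have h2 := norm_ne_zero_iff.2 h0
          change c < ‖T x‖⁻¹ * ‖((‖T x‖ : ℝ) : ℂ)‖ ^ 2
          rw [this, sq, inv_mul_cancel_left₀ h2]
          exact h
    · calc c < ‖inner ℂ y (T x)‖ := h
        _ ≤ ‖y‖ * ‖T x‖ := norm_inner_le_norm _ _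
        _ ≤ 1 * ‖T x‖ := by gcongr
        _ = ‖T x‖ := one_mul _
  rw [h1]
  exact isOpen_biUnion fun y _ =>
    isOpen_lt continuous_const (continuous_inner_apply_weak x y).norm

theorem continuous_adjoint_weak [CompleteSpace H] :
    @Continuous (H →L[ℂ] H) (H →L[ℂ] H) (weakOperatorTopology H) (weakOperatorTopology H)
      fun T => ContinuousLinearMap.adjoint T := by
  let _ := weakOperatorTopology H
  refine continuous_iff_continuousAt.2 fun T => tendsto_weakOperatorTopology_iff.2 fun x y => ?_
  have h := ((continuous_inner_apply_weak (H := H) y x).tendsto T)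
  have h2 := (Complex.continuous_conj.tendsto _).comp h
  have h3 : ∀ S : H →L[ℂ] H, inner ℂ y (ContinuousLinearMap.adjoint S x) =
      (starRingEnd ℂ) (inner ℂ x (S y)) := fun S => by
    rw [ContinuousLinearMap.adjoint_inner_right, inner_conj_symm]
  simp only [h3]
  exact h2

theorem unitarySet.norm_apply [CompleteSpace H] {T : H →L[ℂ] H} (hT : T ∈ unitarySet H) (x : H) :
    ‖T x‖ = ‖x‖ :=
  ContinuousLinearMap.norm_map_of_mem_unitary hT x

/-- With norms fixed, `‖T x - T₀ x‖² = 2‖x‖² - 2 Re ⟨T₀ x, T x⟩`, so weak convergence of unitaries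
is strong. -/
theorem continuous_unitary_apply_weak [CompleteSpace H] (x : H) :
    @Continuous (unitarySet H) H ((weakOperatorTopology H).induced Subtype.val) _
      fun T => T.1 x := by
  let _ := weakOperatorTopology H
  refine continuous_iff_continuousAt.2 fun T₀ => tendsto_iff_norm_sub_tendsto_zero.2 ?_
  have h1 : Tendsto (fun T : unitarySet H => inner ℂ (T₀.1 x) (T.1 x)) (𝓝 T₀)
      (𝓝 (inner ℂ (T₀.1 x) (T₀.1 x))) :=
    ((continuous_inner_apply_weak x (T₀.1 x)).comp continuous_subtype_val).tendsto T₀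
  have h2 : Tendsto (fun T : unitarySet H => √(2 * ‖x‖ ^ 2 - 2 *
      (inner ℂ (T₀.1 x) (T.1 x)).re)) (𝓝 T₀) (𝓝 0) := by
    have h3 := ((tendsto_const_nhds (x := 2 * ‖x‖ ^ 2)).sub
      (((Complex.continuous_re.tendsto _).comp h1).const_mul 2)).sqrt
    have h4 : (inner ℂ (T₀.1 x) (T₀.1 x)).re = ‖x‖ ^ 2 := by
      rw [← unitarySet.norm_apply T₀.2 x]
      exact inner_self_eq_norm_sq (𝕜 := ℂ) _
    rw [h4, sub_self, Real.sqrt_zero] at h3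
    exact h3
  refine h2.congr fun T => ?_
  have h5 := @norm_sub_sq ℂ H _ _ _ (T₀.1 x) (T.1 x)
  rw [unitarySet.norm_apply T₀.2, unitarySet.norm_apply T.2] at h5
  change _ = ‖T.1 x - T₀.1 x‖
  rw [norm_sub_rev, ← Real.sqrt_sq (norm_nonneg (T₀.1 x - T.1 x)), h5]
  congr 1
  change _ = ‖x‖ ^ 2 - 2 * (inner ℂ (T₀.1 x) (T.1 x)).re + ‖x‖ ^ 2
  ring

theorem continuous_unitary_pow_apply [CompleteSpace H] {τ : TopologicalSpace (unitarySet H)}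
    (hτ : ∀ x, Continuous fun T : unitarySet H => T.1 x) (n : ℕ) (x : H) :
    Continuous fun T : unitarySet H => (T.1 ^ n) x := by
  induction n with
  | zero => exact continuous_const
  | succ n ih =>
    refine continuous_iff_continuousAt.2 fun T₀ => ?_
    set v := (T₀.1 ^ n) x with hv
    -- Here `T` varies together with its argument; being isometric, it leaves the norm of the
    -- argument unchanged.
    have h1 : Tendsto (fun T : unitarySet H => T.1 ((T.1 ^ n) x - v)) (𝓝 T₀) (𝓝 0) := by
      rw [tendsto_zero_iff_norm_tendsto_zero]
      have h2 := tendsto_iff_norm_sub_tendsto_zero.1 (ih.tendsto T₀)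
      exact h2.congr fun T => (unitarySet.norm_apply T.2 _).symm
    have h3 := h1.add ((hτ v).tendsto T₀)
    rw [zero_add] at h3
    have h4 : (T₀.1 ^ (n + 1)) x = T₀.1 v := by rw [pow_succ', mul_apply_eq_comp]
    change Tendsto _ _ (𝓝 ((T₀.1 ^ (n + 1)) x))
    rw [h4]
    refine h3.congr fun T => ?_
    rw [pow_succ', mul_apply_eq_comp, map_sub, sub_add_cancel]

end Topologies

/-! ### Density of unitaries and of the approximating sets -/

section Density

variable {H : Type*} [NormedAddCommGroup H] [InnerProductSpace ℂ H] [CompleteSpace H]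

theorem LinearIsometryEquiv.coe_mem_unitarySet (V : H ≃ₗᵢ[ℂ] H) :
    (V : H →L[ℂ] H) ∈ unitarySet H :=
  Unitary.coe_symm_linearIsometryEquiv_apply V ▸ (Unitary.linearIsometryEquiv.symm V).2

theorem exists_linearIsometryEquiv_of_mem_unitarySet {T : H →L[ℂ] H} (hT : T ∈ unitarySet H) :
    ∃ W : H ≃ₗᵢ[ℂ] H, (W : H →L[ℂ] H) = T :=
  ⟨Unitary.linearIsometryEquiv ⟨T, hT⟩, Unitary.coe_linearIsometryEquiv_apply ⟨T, hT⟩⟩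

theorem mem_unitarySet_of_norm {T : H →L[ℂ] H} (h1 : ∀ x, ‖T x‖ = ‖x‖)
    (h2 : ∀ x, ‖ContinuousLinearMap.adjoint T x‖ = ‖x‖) : T ∈ unitarySet H := by
  refine Unitary.mem_iff.2 ⟨T.norm_map_iff_adjoint_comp_self.1 h1, ?_⟩
  have := (ContinuousLinearMap.adjoint T).norm_map_iff_adjoint_comp_self.1 h2
  rwa [ContinuousLinearMap.adjoint_adjoint] at this

theorem unitarySet.norm_adjoint_apply {T : H →L[ℂ] H} (hT : T ∈ unitarySet H) (x : H) :
    ‖ContinuousLinearMap.adjoint T x‖ = ‖x‖ :=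
  unitarySet.norm_apply (Unitary.star_mem hT) x

theorem mem_unitarySet_of_norm_of_denseRange {T : H →L[ℂ] H} (h1 : ∀ x, ‖T x‖ = ‖x‖)
    (h2 : DenseRange T) : T ∈ unitarySet H := by
  have h3 := T.norm_map_iff_adjoint_comp_self.1 h1
  refine Unitary.mem_iff.2 ⟨h3, ?_⟩
  have h4 : (fun x => (T * star T) x) = id := by
    refine h2.equalizer (T * star T).continuous continuous_id (funext fun x => ?_)
    have h5 := DFunLike.congr_fun h3 x
    exact congrArg T h5
  exact ContinuousLinearMap.ext fun x => congrFun h4 x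

theorem contractionSet_subset_closure_unitarySet [TopologicalSpace.SeparableSpace H]
    (hH : ¬ FiniteDimensional ℂ H) :
    contractionSet H ⊆ @closure _ (weakOperatorTopology H) (unitarySet H) := by
  classical
  intro T hT
  have h : ∀ s : Finset H, ∃ V : H ≃ₗᵢ[ℂ] H, ∀ x ∈ s, ∀ y ∈ s,
      inner ℂ y (V x) = inner ℂ y (T x) := by
    intro s
    obtain ⟨V, hV⟩ := exists_isometryEquiv_inner_eq hH T hT (Submodule.span ℂ (s : Set H))
    exact ⟨V, fun x hx y hy => hV x (Submodule.subset_span hx) y (Submodule.subset_span hy)⟩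
  choose V hV using h
  let _ := weakOperatorTopology H
  -- Along the net of finite sets `s`, each matrix coefficient is eventually equal to that of `T`.
  refine mem_closure_of_tendsto (b := atTop) (f := fun s => (V s : H →L[ℂ] H))
    (tendsto_weakOperatorTopology_iff.2 fun x y => ?_)
    (Eventually.of_forall fun s => (V s).coe_mem_unitarySet)
  refine tendsto_const_nhds.congr' ?_
  filter_upwards [eventually_ge_atTop ({x, y} : Finset H)] with s hs
  exact (hV s x (hs (by simp)) y (hs (by simp))).symm

theorem isometrySet_subset_closure_unitarySet [TopologicalSpace.SeparableSpace H]
    (hH : ¬ FiniteDimensional ℂ H) :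
    isometrySet H ⊆ @closure _ (strongOperatorTopology H) (unitarySet H) := by
  classical
  intro T hT
  have h : ∀ s : Finset H, ∃ V : H ≃ₗᵢ[ℂ] H, ∀ x ∈ s, V x = T x := by
    intro s
    let φ : Submodule.span ℂ (s : Set H) →ₗᵢ[ℂ] H :=
      ⟨T.toLinearMap ∘ₗ Submodule.subtype _, fun x => hT x⟩
    obtain ⟨V, hV⟩ := φ.exists_linearIsometryEquiv_extension hH hH
    exact ⟨V, fun x hx => hV ⟨x, Submodule.subset_span hx⟩⟩
  choose V hV using h
  let _ := strongOperatorTopology H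
  refine mem_closure_of_tendsto (b := atTop) (f := fun s => (V s : H →L[ℂ] H))
    (tendsto_strongOperatorTopology_iff.2 fun x => ?_)
    (Eventually.of_forall fun s => (V s).coe_mem_unitarySet)
  refine tendsto_const_nhds.congr' ?_
  filter_upwards [eventually_ge_atTop ({x} : Finset H)] with s hs
  exact (hV s x (hs (by simp))).symm

/-- A sufficient condition for a set of unitaries to be dense for the strong* topology. -/
theorem unitarySet_subset_closure_inter {P : Set (H →L[ℂ] H)}
    (hP : ∀ (W : H ≃ₗᵢ[ℂ] H) (E : Submodule ℂ H) [FiniteDimensional ℂ E] (δ : ℝ), 0 < δ →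
      ∃ V : H ≃ₗᵢ[ℂ] H, (V : H →L[ℂ] H) ∈ P ∧ ∀ x ∈ E, W x ∈ E → ‖V x - W x‖ ≤ δ * ‖x‖) :
    unitarySet H ⊆ @closure _ (strongStarOperatorTopology H) (unitarySet H ∩ P) := by
  classical
  intro T hT
  obtain ⟨W, rfl⟩ := exists_linearIsometryEquiv_of_mem_unitarySet hT
  have h : ∀ a : Finset H × ℕ, ∃ V : H ≃ₗᵢ[ℂ] H, (V : H →L[ℂ] H) ∈ P ∧ ∀ x ∈ a.1,
      ‖V x - W x‖ ≤ ‖x‖ * (1 / ((a.2 : ℝ) + 1)) ∧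
        ‖V.symm x - W.symm x‖ ≤ ‖x‖ * (1 / ((a.2 : ℝ) + 1)) := by
    intro a
    -- The images allow `hV` at `x` and at `W⁻¹ x`; the latter controls the inverses, since `‖V⁻¹ x
    -- - W⁻¹ x‖ = ‖x - V W⁻¹ x‖`.
    let s : Finset H := a.1 ∪ a.1.image W ∪ a.1.image W.symm
    obtain ⟨V, hVP, hV⟩ := hP W (Submodule.span ℂ (s : Set H)) (1 / ((a.2 : ℝ) + 1))
      (by positivity)
    refine ⟨V, hVP, fun x hx => ⟨?_, ?_⟩⟩
    · rw [mul_comm]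
      exact hV x (Submodule.subset_span (by simp [s, hx]))
        (Submodule.subset_span (by simp [s, hx]))
    · have h1 := hV (W.symm x)
        (Submodule.subset_span (Finset.mem_coe.2
          (Finset.mem_union_right _ (Finset.mem_image_of_mem _ hx))))
        (by
          rw [W.apply_symm_apply]
          exact Submodule.subset_span (by simp [s, hx]))
      rw [W.apply_symm_apply, W.symm.norm_map, mul_comm] at h1
      rwa [← V.norm_map, map_sub, V.apply_symm_apply, norm_sub_rev]
  choose V hVP hV using h
  have hlim : ∀ c : ℝ, Tendsto (fun a : Finset H × ℕ => c * (1 / ((a.2 : ℝ) + 1))) atTop (𝓝 0) := by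
    intro c
    have h1 := (tendsto_one_div_add_atTop_nhds_zero_nat (𝕜 := ℝ)).const_mul c
    rw [mul_zero] at h1
    rw [← prod_atTop_atTop_eq]
    exact h1.comp tendsto_snd
  have hev : ∀ x : H, ∀ᶠ a : Finset H × ℕ in atTop, x ∈ a.1 := by
    intro x
    filter_upwards [eventually_ge_atTop (({x}, 0) : Finset H × ℕ)] with a ha
    exact ha.1 (by simp)
  let _ := strongStarOperatorTopology H
  refine mem_closure_of_tendsto (b := atTop) (f := fun a => (V a : H →L[ℂ] H))
    (tendsto_strongStarOperatorTopology_iff.2 ⟨fun x => ?_, fun x => ?_⟩)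
    (Eventually.of_forall fun a => ⟨(V a).coe_mem_unitarySet, hVP a⟩)
  · rw [tendsto_iff_norm_sub_tendsto_zero]
    refine squeeze_zero' (Eventually.of_forall fun _ => norm_nonneg _) ?_ (hlim ‖x‖)
    filter_upwards [hev x] with a ha
    exact (hV a x ha).1
  · rw [tendsto_iff_norm_sub_tendsto_zero]
    refine squeeze_zero' (Eventually.of_forall fun _ => norm_nonneg _) ?_ (hlim ‖x‖)
    filter_upwards [hev x] with a ha
    rw [LinearIsometryEquiv.adjoint_eq_symm, LinearIsometryEquiv.adjoint_eq_symm]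
    exact (hV a x ha).2

theorem exists_nat_sqrt_two_div_le {δ : ℝ} (hδ : 0 < δ) : ∃ L : ℕ, 0 < L ∧ √(2 / L) ≤ δ := by
  obtain ⟨L, hL⟩ := exists_nat_gt (2 / δ ^ 2)
  have hL0 : (0 : ℝ) < L := lt_of_le_of_lt (by positivity) hL
  refine ⟨L, by exact_mod_cast hL0, ?_⟩
  rw [Real.sqrt_le_left hδ.le, div_le_iff₀ hL0]
  rw [div_lt_iff₀ (by positivity)] at hL
  linarith

/-- Operators having a late power close to `μ` at the first `k` points of a sequence. -/
def nearRigidSet (d : ℕ → H) (μ : ℂ) (k : ℕ) : Set (H →L[ℂ] H) :=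
  {T | ∃ n, k ≤ n ∧ ∀ i ∈ Finset.range k, ‖(T ^ n) (d i) - μ • d i‖ < 1 / ((k : ℝ) + 1)}

/-- Operators for which some initial segment of the orbit of `x` is orthogonal on average, up to
the error `1 / (k + 1)`. -/
def nearMixingSet (x : H) (k : ℕ) : Set (H →L[ℂ] H) :=
  {T | ∃ N : ℕ, 0 < N ∧ ∑ n ∈ Finset.range N, ∑ m ∈ Finset.range N,
    ‖inner ℂ ((T ^ n) x) ((T ^ m) x)‖ ^ 2 < (N : ℝ) ^ 2 * (1 / ((k : ℝ) + 1))}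

theorem isOpen_nearRigidSet {τ : TopologicalSpace (unitarySet H)}
    (hτ : ∀ x, Continuous fun T : unitarySet H => T.1 x) (d : ℕ → H) (μ : ℂ) (k : ℕ) :
    IsOpen (Subtype.val ⁻¹' nearRigidSet d μ k : Set (unitarySet H)) := by
  have h : (Subtype.val ⁻¹' nearRigidSet d μ k : Set (unitarySet H)) =
      ⋃ n, ⋃ (_ : k ≤ n), ⋂ i ∈ Finset.range k,
        {T | ‖(T.1 ^ n) (d i) - μ • d i‖ < 1 / ((k : ℝ) + 1)} := by
    ext T
    simp [nearRigidSet]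
  rw [h]
  exact isOpen_iUnion fun n => isOpen_iUnion fun _ => isOpen_biInter_finset fun i _ =>
    isOpen_lt ((continuous_unitary_pow_apply hτ n (d i)).sub continuous_const).norm
      continuous_const

theorem isOpen_nearMixingSet {τ : TopologicalSpace (unitarySet H)}
    (hτ : ∀ x, Continuous fun T : unitarySet H => T.1 x) (x : H) (k : ℕ) :
    IsOpen (Subtype.val ⁻¹' nearMixingSet x k : Set (unitarySet H)) := by
  have h : (Subtype.val ⁻¹' nearMixingSet x k : Set (unitarySet H)) =
      ⋃ N : ℕ, ⋃ (_ : 0 < N), {T | ∑ n ∈ Finset.range N, ∑ m ∈ Finset.range N,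
        ‖inner ℂ ((T.1 ^ n) x) ((T.1 ^ m) x)‖ ^ 2 < (N : ℝ) ^ 2 * (1 / ((k : ℝ) + 1))} := by
    ext T
    simp [nearMixingSet]
  rw [h]
  refine isOpen_iUnion fun N => isOpen_iUnion fun _ => isOpen_lt ?_ continuous_const
  exact continuous_finsetSum _ fun n _ => continuous_finsetSum _ fun m _ =>
    (((continuous_unitary_pow_apply hτ n x).inner
      (continuous_unitary_pow_apply hτ m x)).norm.pow 2)

theorem unitarySet_subset_closure_nearRigidSet [TopologicalSpace.SeparableSpace H]
    (hH : ¬ FiniteDimensional ℂ H) (d : ℕ → H) (μ : Circle) (k : ℕ) :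
    unitarySet H ⊆
      @closure _ (strongStarOperatorTopology H) (unitarySet H ∩ nearRigidSet d μ k) := by
  refine unitarySet_subset_closure_inter fun W E _ δ hδ => ?_
  obtain ⟨L, hL, hLδ⟩ := exists_nat_sqrt_two_div_le hδ
  obtain ⟨V, hVW, hVμ, -⟩ := W.exists_near_pow_eq_smul hH E μ hL (N := L + 1 + k) (by omega)
  refine ⟨V, ⟨L + 1 + k, by omega, fun i _ => ?_⟩, fun x hx hWx => (hVW x hx hWx).trans ?_⟩
  · rw [LinearIsometryEquiv.coe_pow_apply, hVμ, sub_self, norm_zero]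
    positivity
  · gcongr

theorem unitarySet_subset_closure_nearMixingSet [TopologicalSpace.SeparableSpace H]
    (hH : ¬ FiniteDimensional ℂ H) (x : H) (k : ℕ) :
    unitarySet H ⊆
      @closure _ (strongStarOperatorTopology H) (unitarySet H ∩ nearMixingSet x k) := by
  refine unitarySet_subset_closure_inter fun W E _ δ hδ => ?_
  obtain ⟨L, hL, hLδ⟩ := exists_nat_sqrt_two_div_le hδ
  -- Chosen so that the banded bound `M · 2L‖x‖⁴` falls below `M² / (k + 1)`.
  obtain ⟨M, hM⟩ := exists_nat_gt (2 * L * ‖x‖ ^ 4 * (k + 1))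
  have hM0 : (0 : ℝ) < M := lt_of_le_of_lt (by positivity) hM
  have hM1 : 0 < M := by exact_mod_cast hM0
  -- Period `M + L` makes the orthogonality reach all `m` with `L ≤ m ≤ M`; the scalar `1` is
  -- arbitrary.
  obtain ⟨V, hVW, -, hV⟩ := W.exists_near_pow_eq_smul hH (E ⊔ Submodule.span ℂ {x}) 1 hL
    (N := M + L) (by omega)
  have hxE : x ∈ E ⊔ Submodule.span ℂ {x} :=
    Submodule.mem_sup_right (Submodule.mem_span_singleton_self x)
  refine ⟨V, ⟨M, hM1, ?_⟩, fun y hy hWy =>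
    (hVW y (Submodule.mem_sup_left hy) (Submodule.mem_sup_left hWy)).trans (by gcongr)⟩
  refine (sum_sum_norm_inner_sq_le_of_isometry (L := L) (fun y => V.norm_map y)
    fun m hm hmM => ?_).trans_lt ?_
  · rw [LinearIsometryEquiv.coe_pow_apply]
    exact hV x hxE x hxE m hm (by omega)
  · rw [mul_one_div, lt_div_iff₀ (by positivity), sq, mul_assoc]
    gcongr

end Density

/-! ### From the approximating sets to the theorem -/

section Assembly

variable {H : Type*} [NormedAddCommGroup H] [InnerProductSpace ℂ H]

theorem isRigidAt_of_mem_nearRigidSet {T : H →L[ℂ] H} (hT : ∀ x, ‖T x‖ = ‖x‖) {d : ℕ → H}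
    (hd : DenseRange d) (μ : Circle) (h : ∀ k, T ∈ nearRigidSet d μ k) : IsRigidAt T μ := by
  choose n hn hnd using h
  refine ⟨n, tendsto_atTop_mono hn tendsto_id, tendsto_strongOperatorTopology_iff.2 fun x => ?_⟩
  rw [Metric.tendsto_atTop]
  intro ε hε
  obtain ⟨i, hi⟩ := hd.exists_dist_lt x (ε := ε / 3) (by positivity)
  rw [dist_eq_norm] at hi
  obtain ⟨K, hK⟩ := exists_nat_one_div_lt (K := ℝ) (ε := ε / 3) (by positivity)
  -- From `i + 1` on, `d i` is among the tested vectors.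
  refine ⟨max K (i + 1), fun k hk => ?_⟩
  have h1 := hnd k i (Finset.mem_range.2 (by have := le_of_max_le_right hk; omega))
  have h2 : 1 / ((k : ℝ) + 1) ≤ 1 / ((K : ℝ) + 1) := by
    have : (K : ℝ) ≤ k := by exact_mod_cast le_of_max_le_left hk
    gcongr
  have h3 : (T ^ n k) x - (μ : ℂ) • x = (T ^ n k) (x - d i) +
      ((T ^ n k) (d i) - (μ : ℂ) • d i) - (μ : ℂ) • (x - d i) := by
    rw [map_sub, smul_sub]
    abel
  have h4 : ‖(T ^ n k) (x - d i)‖ = ‖x - d i‖ := norm_pow_apply_of_isometry hT _ _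
  have h5 : ‖(μ : ℂ) • (x - d i)‖ = ‖x - d i‖ := by rw [norm_smul, μ.norm_coe, one_mul]
  rw [dist_eq_norm]
  change ‖(T ^ n k) x - (μ : ℂ) • x‖ < ε
  rw [h3]
  have h6 := norm_sub_le ((T ^ n k) (x - d i) + ((T ^ n k) (d i) - (μ : ℂ) • d i))
    ((μ : ℂ) • (x - d i))
  have h7 := norm_add_le ((T ^ n k) (x - d i)) ((T ^ n k) (d i) - (μ : ℂ) • d i)
  linarith

theorem isAlmostWeaklyStable_of_mem_nearMixingSet [CompleteSpace H] {T : H →L[ℂ] H}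
    (hT : ∀ x, ‖T x‖ = ‖x‖) {d : ℕ → H × H} (hd : DenseRange d)
    (h : ∀ p k, T ∈ nearMixingSet (d p).1 k) : IsAlmostWeaklyStable T := by
  have hces : ∀ p, Tendsto (fun K : ℕ => (∑ n ∈ Finset.Icc 1 K,
      ‖inner ℂ ((T ^ n) (d p).1) (d p).2‖ ^ 2) / K) atTop (𝓝 0) := by
    intro p
    refine tendsto_cesaro_norm_inner_sq hT (fun ε hε => ?_) _
    obtain ⟨k, hk⟩ := exists_nat_one_div_lt (K := ℝ) hε
    obtain ⟨N, hN, hs⟩ := h p k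
    exact ⟨N, hN, hs.le.trans (by gcongr)⟩
  obtain ⟨n, hn, hdens, ht⟩ := exists_common_strictMono_hasNatDensity_one
    (C := fun p => (‖(d p).1‖ * ‖(d p).2‖) ^ 2) (fun p n => by positivity) (fun p n => by
      have h1 := norm_inner_le_norm (𝕜 := ℂ) ((T ^ n) (d p).1) (d p).2
      rw [norm_pow_apply_of_isometry hT] at h1
      gcongr) hces
  refine ⟨n, hn, hdens, tendsto_weakOperatorTopology_iff.2 fun x y => ?_⟩
  rw [zero_apply, inner_zero_right, Metric.tendsto_atTop]
  intro ε hε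
  -- Replacing `(x, y)` by `d p` costs at most `δ‖y‖ + (‖x‖ + 1)δ ≤ ε / 2`; the bound `δ ≤ 1` gives
  -- `‖(d p).1‖ ≤ ‖x‖ + 1`.
  set δ : ℝ := min 1 (ε / (2 * (‖x‖ + ‖y‖ + 1))) with hδ
  have hδ0 : 0 < δ := lt_min one_pos (by positivity)
  obtain ⟨p, hp⟩ := hd.exists_dist_lt (x, y) hδ0
  rw [Prod.dist_eq, max_lt_iff, dist_eq_norm, dist_eq_norm] at hp
  obtain ⟨hpx, hpy⟩ := hp
  have hδ1 : δ * (‖x‖ + ‖y‖ + 1) ≤ ε / 2 := by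
    have h1 := mul_le_mul_of_nonneg_right (min_le_right 1 (ε / (2 * (‖x‖ + ‖y‖ + 1))))
      (by positivity : 0 ≤ ‖x‖ + ‖y‖ + 1)
    refine h1.trans (le_of_eq ?_)
    field_simp
  obtain ⟨J, hJ⟩ := Metric.tendsto_atTop.1 (ht p) ((ε / 2) ^ 2) (by positivity)
  refine ⟨J, fun j hj => ?_⟩
  have h1 := hJ j hj
  rw [Real.dist_eq, sub_zero, abs_of_nonneg (by positivity)] at h1
  have h2 := lt_of_pow_lt_pow_left₀ 2 (by positivity) h1
  set S := T ^ n j with hS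
  have hSn : ∀ z, ‖S z‖ = ‖z‖ := norm_pow_apply_of_isometry hT _
  have h3 : inner ℂ (S x) y = inner ℂ (S (d p).1) (d p).2 + inner ℂ (S (x - (d p).1)) y +
      inner ℂ (S (d p).1) (y - (d p).2) := by
    rw [map_sub, inner_sub_left, inner_sub_right]
    ring
  have h4 := norm_inner_le_norm (𝕜 := ℂ) (S (x - (d p).1)) y
  have h5 := norm_inner_le_norm (𝕜 := ℂ) (S (d p).1) (y - (d p).2)
  rw [hSn] at h4 h5
  have h6 : ‖(d p).1‖ ≤ ‖x‖ + 1 := by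
    have h7 := norm_sub_norm_le (d p).1 x
    rw [norm_sub_rev] at h7
    linarith [min_le_left 1 (ε / (2 * (‖x‖ + ‖y‖ + 1)))]
  have h7 : ‖x - (d p).1‖ * ‖y‖ ≤ δ * ‖y‖ := by gcongr
  have h8 : ‖(d p).1‖ * ‖y - (d p).2‖ ≤ (‖x‖ + 1) * δ := by gcongr
  have h9 := norm_add₃_le (a := inner ℂ (S (d p).1) (d p).2) (b := inner ℂ (S (x - (d p).1)) y)
    (c := inner ℂ (S (d p).1) (y - (d p).2))
  rw [dist_zero_right, norm_inner_symm, h3]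
  linarith

variable [CompleteSpace H] [TopologicalSpace.SeparableSpace H]

/-- Common core of the three cases: strong* density passes to the coarser `t`, and openness needs
only `htc`. -/
theorem isResidualIn_of_dense_unitarySet (hH : ¬ FiniteDimensional ℂ H) {Λ : Set Circle}
    (hΛ : Λ.Countable) {t : TopologicalSpace (H →L[ℂ] H)} (ht : strongStarOperatorTopology H ≤ t)
    (htc : ∀ x, @Continuous (unitarySet H) H (t.induced Subtype.val) _ fun T => T.1 x)
    {A : Set (H →L[ℂ] H)} (hUA : unitarySet H ⊆ A) (hdense : A ⊆ @closure _ t (unitarySet H))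
    {ι : Type*} [Countable ι] {G : ι → Set (H →L[ℂ] H)} (hG : ∀ i, IsOpen[t] (G i))
    (hUG : ∀ i, unitarySet H ⊆ G i) (hGU : ∀ T ∈ A, (∀ i, T ∈ G i) → T ∈ unitarySet H) :
    IsResidualIn t A {T | IsAlmostWeaklyStable T ∧ ∀ μ ∈ Λ, IsRigidAt T (μ : ℂ)} := by
  have := hΛ.to_subtype
  let d := TopologicalSpace.denseSeq H
  let e := TopologicalSpace.denseSeq (H × H)
  let P : (ℕ × ℕ) ⊕ (Λ × ℕ) → Set (H →L[ℂ] H) :=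
    Sum.elim (fun q => nearMixingSet (e q.1).1 q.2)
      fun q => nearRigidSet d ((q.1 : Circle) : ℂ) q.2
  refine isResidualIn_of_dense_subset hUA hdense hG hUG hGU (P := P) ?_ ?_ ?_
  · rintro (q | q)
    · exact isOpen_nearMixingSet htc _ _
    · exact isOpen_nearRigidSet htc _ _ _
  · rintro (q | q)
    · exact (unitarySet_subset_closure_nearMixingSet hH _ _).trans (closure.mono ht)
    · exact (unitarySet_subset_closure_nearRigidSet hH _ _ _).trans (closure.mono ht)
  · intro T hT hTP
    have hTn := unitarySet.norm_apply hT
    exact ⟨isAlmostWeaklyStable_of_mem_nearMixingSet hTn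
        (TopologicalSpace.denseRange_denseSeq (H × H)) fun p k => hTP (Sum.inl (p, k)),
      fun μ hμ => isRigidAt_of_mem_nearRigidSet hTn (TopologicalSpace.denseRange_denseSeq H) μ
        fun k => hTP (Sum.inr (⟨μ, hμ⟩, k))⟩

theorem strongStarOperatorTopology_le_strong {H : Type*} [NormedAddCommGroup H]
    [InnerProductSpace ℂ H] [CompleteSpace H] :
    strongStarOperatorTopology H ≤ strongOperatorTopology H := inf_le_left

theorem continuous_unitary_apply_of_le_strong {H : Type*} [NormedAddCommGroup H]
    [InnerProductSpace ℂ H] [CompleteSpace H] {t : TopologicalSpace (H →L[ℂ] H)}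
    (ht : t ≤ strongOperatorTopology H) (x : H) :
    @Continuous (unitarySet H) H (t.induced Subtype.val) _ fun T => T.1 x :=
  continuous_le_dom (induced_mono ht) (@Continuous.comp _ _ _
    ((strongOperatorTopology H).induced Subtype.val) (strongOperatorTopology H) _ _ _
    (continuous_apply_strong x) continuous_induced_dom)

theorem norm_eq_of_denseRange {H : Type*} [NormedAddCommGroup H] [InnerProductSpace ℂ H]
    {S : H →L[ℂ] H} (hS : ‖S‖ ≤ 1) {d : ℕ → H} (hd : DenseRange d)
    (h : ∀ i m : ℕ, ‖d i‖ - 1 / ((m : ℝ) + 1) < ‖S (d i)‖) (x : H) : ‖S x‖ = ‖x‖ := by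
  have h1 : (fun x => ‖S x‖) = fun x => ‖x‖ := by
    refine hd.equalizer S.continuous.norm continuous_norm (funext fun i => le_antisymm ?_ ?_)
    · simpa using S.le_of_opNorm_le hS (d i)
    · refine le_of_forall_pos_le_add fun ε hε => ?_
      obtain ⟨m, hm⟩ := exists_nat_one_div_lt (K := ℝ) hε
      change ‖d i‖ ≤ ‖S (d i)‖ + ε
      linarith [h i m]
  exact congrFun h1 x

end Assembly

theorem mainTheorem1 {H : Type*} [NormedAddCommGroup H] [InnerProductSpace ℂ H]
    [CompleteSpace H] [TopologicalSpace.SeparableSpace H]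
    (hH : ¬ FiniteDimensional ℂ H) (Λ : Set Circle) (hΛ : Λ.Countable) :
    IsResidualIn (weakOperatorTopology H) (contractionSet H)
        {T | IsAlmostWeaklyStable T ∧ ∀ μ ∈ Λ, IsRigidAt T (μ : ℂ)} ∧
      IsResidualIn (strongOperatorTopology H) (isometrySet H)
        {T | IsAlmostWeaklyStable T ∧ ∀ μ ∈ Λ, IsRigidAt T (μ : ℂ)} ∧
      IsResidualIn (strongStarOperatorTopology H) (unitarySet H)
        {T | IsAlmostWeaklyStable T ∧ ∀ μ ∈ Λ, IsRigidAt T (μ : ℂ)} := by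
  have hd := TopologicalSpace.denseRange_denseSeq H
  set d := TopologicalSpace.denseSeq H
  refine ⟨?_, ?_, ?_⟩
  · refine isResidualIn_of_dense_unitarySet hH hΛ
      (strongStarOperatorTopology_le_strong.trans strongOperatorTopology_le_weak)
      continuous_unitary_apply_weak
      (fun T hT => T.opNorm_le_bound zero_le_one fun x => by
        rw [unitarySet.norm_apply hT, one_mul])
      (contractionSet_subset_closure_unitarySet hH)
      -- Among contractions, these conditions say that `T` and its adjoint are both isometric.
      (G := fun q : ℕ × ℕ => {T | ‖d q.1‖ - 1 / ((q.2 : ℝ) + 1) < ‖T (d q.1)‖} ∩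
        (fun T => ContinuousLinearMap.adjoint T) ⁻¹'
          {T | ‖d q.1‖ - 1 / ((q.2 : ℝ) + 1) < ‖T (d q.1)‖})
      (fun q => ?_) (fun q T hT => ⟨?_, ?_⟩) fun T hT hTG => mem_unitarySet_of_norm
        (norm_eq_of_denseRange hT hd fun i m => (hTG (i, m)).1)
        (norm_eq_of_denseRange
          (((ContinuousLinearMap.adjoint (𝕜 := ℂ) (E := H) (F := H)).norm_map T).trans_le hT) hd
            fun i m => (hTG (i, m)).2)
    · have h1 := isOpen_lt_norm_apply_weak (d q.1) (‖d q.1‖ - 1 / ((q.2 : ℝ) + 1))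
      have h2 := @IsOpen.preimage _ _ (weakOperatorTopology H) (weakOperatorTopology H) _
        continuous_adjoint_weak _ h1
      exact @TopologicalSpace.isOpen_inter _ (weakOperatorTopology H) _ _ h1 h2
    · change _ < ‖T _‖
      rw [unitarySet.norm_apply hT]
      exact sub_lt_self _ (by positivity)
    · change _ < ‖ContinuousLinearMap.adjoint T _‖
      rw [unitarySet.norm_adjoint_apply hT]
      exact sub_lt_self _ (by positivity)
  · refine isResidualIn_of_dense_unitarySet hH hΛ strongStarOperatorTopology_le_strong
      (continuous_unitary_apply_of_le_strong le_rfl) (fun T hT => unitarySet.norm_apply hT)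
      (isometrySet_subset_closure_unitarySet hH)
      -- These conditions say that the range is dense, which makes an isometry unitary.
      (G := fun q : ℕ × ℕ => ⋃ y : H, {T | ‖T y - d q.1‖ < 1 / ((q.2 : ℝ) + 1)})
      (fun q => ?_) (fun q T hT => ?_) fun T hT hTG =>
        mem_unitarySet_of_norm_of_denseRange hT ?_
    · let _ := strongOperatorTopology H
      exact isOpen_iUnion fun y => isOpen_lt ((continuous_apply_strong y).sub continuous_const).norm
        continuous_const
    · refine Set.mem_iUnion.2 ⟨ContinuousLinearMap.adjoint T (d q.1), ?_⟩
      have h1 : T (ContinuousLinearMap.adjoint T (d q.1)) = d q.1 :=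
        DFunLike.congr_fun (Unitary.mem_iff.1 hT).2 (d q.1)
      change ‖T _ - _‖ < _
      rw [h1, sub_self, norm_zero]
      positivity
    · refine dense_iff_closure_eq.2 (Set.eq_univ_of_univ_subset ?_)
      rw [← hd.closure_range]
      refine closure_minimal ?_ isClosed_closure
      rintro _ ⟨i, rfl⟩
      refine Metric.mem_closure_range_iff.2 fun ε hε => ?_
      obtain ⟨m, hm⟩ := exists_nat_one_div_lt (K := ℝ) hε
      obtain ⟨y, hy⟩ := Set.mem_iUnion.1 (hTG (i, m))
      refine ⟨y, ?_⟩
      rw [dist_comm, dist_eq_norm]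
      exact lt_trans hy hm
  · exact isResidualIn_of_dense_unitarySet hH hΛ le_rfl
      (continuous_unitary_apply_of_le_strong strongStarOperatorTopology_le_strong) subset_rfl
      (@subset_closure _ (strongStarOperatorTopology H) _) (ι := Empty) (G := Empty.elim)
      (fun i => i.elim) (fun i => i.elim) fun T hT _ => hT
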